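/- Let $d\ge 2$ and let $\lambda^*=\frac{H_d-1}{d-1}$, where $H_d=\sum_{n=1}^d\frac1n$. A sharp observable (PVM) on $\mathbb C^d$ is a family $A=(A(x))_{x\in O}$ of orthogonal projections, indexed by a finite outcome set $O$, with $\sum_x A(x)=\mathbb 1$. Mixing $A$ with white noise at visibility $\lambda$ gives $$A^{\lambda}(x)=\lambda A(x)+\frac{1-\lambda}{d}\,\mathrm{tr}[A(x)]\,\mathbb 1 .$$ A (possibly infinite) family $(E_k)_{k\in K}$ of observables on $\mathbb C^d$ is called jointly measurable if there are a measurable space $\Lambda$, a POVM $G$ on $\Lambda$ (a $\sigma$-additive map from the measurable subsets of $\Lambda$ to the positive semidefinite $d\times d$ matrices with $G(\Lambda)=\mathbb 1$), and functions $D(x|k,\cdot)\ge 0$, measurable on $\Lambda$ with $\sum_x D(x|k,l)=1$ for all $k,l$, such that $$\langle\psi,E_k(x)\psi\rangle=\int_\Lambda D(x|k,l)\,\langle\psi,G(dl)\psi\rangle\qquad\text{for all } k,\,x,\,\psi\in\mathbb C^d .$$ Then: (1) For every family $(A_k)_{k\in K}$ of PVMs on $\mathbb C^d$, finite or infinite,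 the family $(A_k^{\lambda^*})_{k\in K}$ is jointly measurable. If $K$ is finite, then there is a parent POVM with finitely many outcomes: there are positive semidefinite matrices $G(1),\dots,G(n)$ with $\sum_l G(l)=\mathbb 1$ and numbers $D_l(x|k)\ge0$ with $\sum_xD_l(x|k)=1$ such that $A_k^{\lambda^*}(x)=\sum_l D_l(x|k)\,G(l)$ for all $k,x$. (2) For every $\lambda$ with $\lambda^*<\lambda\le 1$ there is a finite family $(A_k)$ of PVMs on $\mathbb C^d$ such that $(A_k^{\lambda})$ is not jointly measurable. -/

import Mathlib

open MeasureTheory Matrix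
open scoped ComplexOrder

universe u v w

namespace QM

/-- A discrete POVM on `ℂ^d` with finite outcome set `O`: positive semidefinite effects that sum to
the identity. -/
structure IsPOVM {d : ℕ} {O : Type*} [Fintype O] (E : O → Matrix (Fin d) (Fin d) ℂ) : Prop where
  posSemidef : ∀ x, (E x).PosSemidef
  sum_eq_one : ∑ x, E x = 1

/-- A sharp observable (PVM) on `ℂ^d` with finite outcome set `O`: orthogonal projections that sum
to the identity. (Mutual orthogonality of the projections is then automatic.) -/
structure IsPVM {d : ℕ} {O : Type*} [Fintype O] (A : O → Matrix (Fin d) (Fin d) ℂ) : Prop where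
  isStarProjection : ∀ x, IsStarProjection (A x)
  sum_eq_one : ∑ x, A x = 1

/-- Mixing with white noise at visibility `t`:
`A^t(x) = t A(x) + ((1 - t) / d) tr[A(x)] 1`. -/
noncomputable def noisy {d : ℕ} {O : Type*} (t : ℝ) (A : O → Matrix (Fin d) (Fin d) ℂ) :
    O → Matrix (Fin d) (Fin d) ℂ :=
  fun x => (t : ℂ) • A x + (((1 - t : ℝ) : ℂ) / (d : ℂ) * (A x).trace) • 1

/-- A POVM on `ℂ^d` over an arbitrary measurable outcome space `L`: a σ-additive map from the
measurable sets to the positive semidefinite matrices that sends the whole space to the identity. -/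
structure POVM (d : ℕ) (L : Type*) [MeasurableSpace L] where
  /-- the underlying matrix-valued measure -/
  toVectorMeasure : VectorMeasure L (Matrix (Fin d) (Fin d) ℂ)
  posSemidef : ∀ s, MeasurableSet s → (toVectorMeasure s).PosSemidef
  univ_eq_one : toVectorMeasure Set.univ = 1

namespace POVM

variable {d : ℕ} {L : Type*} [MeasurableSpace L]

theorem hasSum_re (G : POVM d L) (ψ : Fin d → ℂ) {f : ℕ → Set L}
    (hf : ∀ i, MeasurableSet (f i)) (hd : Pairwise (Function.onFun Disjoint f)) :
    HasSum (fun i => (star ψ ⬝ᵥ (G.toVectorMeasure (f i) *ᵥ ψ)).re)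
      (star ψ ⬝ᵥ (G.toVectorMeasure (⋃ i, f i) *ᵥ ψ)).re := by
  have h := G.toVectorMeasure.m_iUnion hf hd
  let φ : Matrix (Fin d) (Fin d) ℂ →+ ℝ :=
    { toFun := fun M => (star ψ ⬝ᵥ (M *ᵥ ψ)).re
      map_zero' := by simp
      map_add' := fun M N => by simp [Matrix.add_mulVec, dotProduct_add] }
  have hφ : Continuous φ := by
    change Continuous fun M : Matrix (Fin d) (Fin d) ℂ => (star ψ ⬝ᵥ (M *ᵥ ψ)).re
    fun_prop
  exact h.map φ hφ

/-- The outcome distribution of `G` in the pure state `ψ`: the measure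
`s ↦ ⟨ψ, G(s) ψ⟩` (a probability measure when `ψ` is a unit vector). -/
noncomputable def bornMeasure (G : POVM d L) (ψ : Fin d → ℂ) : Measure L :=
  Measure.ofMeasurable
    (fun s _ => ENNReal.ofReal (star ψ ⬝ᵥ (G.toVectorMeasure s *ᵥ ψ)).re)
    (by simp)
    (by
      intro f hf hd
      have h := G.hasSum_re ψ hf hd
      rw [← h.tsum_eq, ENNReal.ofReal_tsum_of_nonneg _ h.summable]
      exact fun i => (G.posSemidef _ (hf i)).re_dotProduct_nonneg ψ)

theorem bornMeasure_apply (G : POVM d L) (ψ : Fin d → ℂ) {s : Set L} (hs : MeasurableSet s) :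
    G.bornMeasure ψ s = ENNReal.ofReal (star ψ ⬝ᵥ (G.toVectorMeasure s *ᵥ ψ)).re :=
  Measure.ofMeasurable_apply s hs

end POVM

/-- `D x k l` is a classical post-processing `D_l(x|k)`: for every setting `k` and every value `l`
of the parent observable it is a probability distribution on the outcomes `x` of setting `k`. -/
structure IsPostProcessing {K : Type*} {O : K → Type*} [∀ k, Fintype (O k)] {L : Type*}
    (D : ∀ k, O k → L → ℝ) : Prop where
  nonneg : ∀ k x l, 0 ≤ D k x l
  sum_eq_one : ∀ k l, ∑ x, D k x l = 1

/-- Joint measurability of a (possibly infinite) family of observables `E k`: there is one POVM `G`,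
on some measurable space, from which the outcome probabilities of all the `E k`, in every pure
state `ψ`, are obtained by classical post-processing, i.e. `E k x = ∫ D_l(x|k) G(dl)` weakly. -/
def JointlyMeasurable {d : ℕ} {K : Type u} {O : K → Type v} [∀ k, Fintype (O k)]
    (E : ∀ k, O k → Matrix (Fin d) (Fin d) ℂ) : Prop :=
  ∃ (L : Type w) (_ : MeasurableSpace L) (G : POVM d L) (D : ∀ k, O k → L → ℝ),
    IsPostProcessing D ∧ (∀ k x, Measurable (D k x)) ∧
      ∀ (k : K) (x : O k) (ψ : Fin d → ℂ),
        star ψ ⬝ᵥ (E k x *ᵥ ψ) = ((∫ l, D k x l ∂(G.bornMeasure ψ) : ℝ) : ℂ)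

/-- Joint measurability with a parent observable that has finitely many outcomes:
`E k x = ∑ l, D_l(x|k) G(l)`. -/
def FinitelyJointlyMeasurable {d : ℕ} {K : Type u} {O : K → Type v} [∀ k, Fintype (O k)]
    (E : ∀ k, O k → Matrix (Fin d) (Fin d) ℂ) : Prop :=
  ∃ (n : ℕ) (G : Fin n → Matrix (Fin d) (Fin d) ℂ) (D : ∀ k, O k → Fin n → ℝ),
    IsPOVM G ∧ IsPostProcessing D ∧ ∀ k x, ∑ l, (D k x l : ℂ) • G l = E k x

/-- The threshold visibility `(H_d - 1) / (d - 1)`, with `H_d = ∑_{n=1}^d 1/n`. -/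
noncomputable def threshold (d : ℕ) : ℝ :=
  ((harmonic d : ℝ) - 1) / ((d : ℝ) - 1)

end QM

namespace QM

open ProbabilityTheory

/-! One parent observable serves all PVMs: sample `z ∈ ℂ^d` from the POVM `|z⟩⟨z| γ(dz) / 2`, with
`γ` the standard complex Gaussian law, and, asked for a basis, answer with the index at which `z`
has the largest coordinate in that basis. Unitary invariance of `γ` reduces every basis to the
standard one (`gaussMatrix_comp_mulVec`). There, sign flips make the simulated effect diagonal and
permutations leave only two distinct diagonal values. The `|z_i|² / 2` are independent unit
exponentials, whose maximum has mean `H_d`; this fixes both values and yields visibility `λ*`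
(`gaussMatrix_maxWeight_comp`). A general PVM is a coarse-graining of a basis
(`IsPVM.exists_basis`).

For optimality, score a parent by the sum of `⟨u_x, E_k(x) u_x⟩` over the vectors of each basis,
averaged over bases. For a rank-one effect the best answer is again the largest overlap, whose Haar
average is `H_d / d` times the squared Euclidean norm (`integral_norm_sq_star_mulVec_haar`).
Finitely many bases come within `ε` of it uniformly (`exists_finite_average`), so any parent scores
at most `H_d + dε` (`sum_integral_le`), whereas noisy bases at visibility `t` score `dt + 1 - t`,
which exceeds `H_d` once `t > λ*`.

Throughout, `‖z‖` on `Fin d → ℂ` is the sup norm, so `‖z‖ ^ 2` is the largest squared modulus. -/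

/-! ### Complex Gaussian vectors and their largest coordinate -/

lemma stdGaussian_complex_eq_map_prod :
    stdGaussian ℂ = ((gaussianReal 0 1).prod (gaussianReal 0 1)).map
      Complex.measurableEquivRealProd.symm := by
  rw [stdGaussian_eq_map_pi_orthonormalBasis Complex.orthonormalBasisOneI]
  have h := (measurePreserving_piFinTwo (fun _ : Fin 2 => gaussianReal 0 1)).map_eq
  rw [← h, Measure.map_map (by fun_prop) (by fun_prop)]
  congr 1
  ext x
  simp [Complex.coe_orthonormalBasisOneI, Complex.measurableEquivRealProd, Complex.ext_iff]

/-- In polar coordinates the radial density `x e^{-x²/2}` has an elementary primitive. Thus `|z|² /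
2` is exponential with mean 1, the source of the factors 2 below. -/
lemma stdGaussian_complex_closedBall {r : ℝ} (hr : 0 ≤ r) :
    stdGaussian ℂ (Metric.closedBall 0 r) = ENNReal.ofReal (1 - Real.exp (-r ^ 2 / 2)) := by
  have hint : ∫⁻ x in Set.Ioc 0 r, ENNReal.ofReal (x * Real.exp (-x ^ 2 / 2)) =
      ENNReal.ofReal (1 - Real.exp (-r ^ 2 / 2)) := by
    have hc : Continuous fun x : ℝ => x * Real.exp (-x ^ 2 / 2) := by fun_prop
    rw [← ofReal_integral_eq_lintegral_ofReal, ← intervalIntegral.integral_of_le hr,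
      intervalIntegral.integral_eq_sub_of_hasDerivAt (f := fun x => -Real.exp (-x ^ 2 / 2))]
    · simp; ring_nf
    · intro x _
      have := ((((hasDerivAt_id x).pow 2).neg.div_const 2).exp).neg
      refine this.congr_deriv ?_
      simp
      ring
    · exact hc.intervalIntegrable _ _
    · exact (hc.integrableOn_Icc (a := 0) (b := r)).mono_set Set.Ioc_subset_Icc_self
    · filter_upwards [ae_restrict_mem measurableSet_Ioc] with x hx
      have := hx.1.le
      simp only [Pi.zero_apply]; positivity
  have hden : (gaussianReal 0 1).prod (gaussianReal 0 1) = (volume : Measure (ℝ × ℝ)).withDensity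
      fun p => gaussianPDF 0 1 p.1 * gaussianPDF 0 1 p.2 := by
    rw [gaussianReal_of_var_ne_zero _ one_ne_zero,
      prod_withDensity (measurable_gaussianPDF 0 1) (measurable_gaussianPDF 0 1)]
    rfl
  have hmeas : MeasurableSet {p : ℝ × ℝ | p.1 ^ 2 + p.2 ^ 2 ≤ r ^ 2} :=
    measurableSet_le (by fun_prop) (by fun_prop)
  have hpre : Complex.measurableEquivRealProd.symm ⁻¹' Metric.closedBall 0 r =
      {p : ℝ × ℝ | p.1 ^ 2 + p.2 ^ 2 ≤ r ^ 2} := by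
    ext p
    rw [Set.mem_preimage, mem_closedBall_zero_iff, ← sq_le_sq₀ (norm_nonneg _) hr, Complex.sq_norm,
      Complex.normSq_apply]
    simp [Complex.measurableEquivRealProd, sq]
  rw [stdGaussian_complex_eq_map_prod, MeasurableEquiv.map_apply, hpre, hden,
    withDensity_apply _ hmeas, ← lintegral_indicator hmeas, ← lintegral_comp_polarCoord_symm,
    polarCoord_target]
  have hfun : ∀ p ∈ Set.Ioi (0 : ℝ) ×ˢ Set.Ioo (-Real.pi) Real.pi,
      ENNReal.ofReal p.1 • {p : ℝ × ℝ | p.1 ^ 2 + p.2 ^ 2 ≤ r ^ 2}.indicator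
        (fun p => gaussianPDF 0 1 p.1 * gaussianPDF 0 1 p.2) (polarCoord.symm p) =
      (Set.Iic r).indicator (fun x => ENNReal.ofReal (x * Real.exp (-x ^ 2 / 2))) p.1 *
        ENNReal.ofReal ((2 * Real.pi)⁻¹) := by
    rintro ⟨x, θ⟩ ⟨hx, -⟩
    have hx0 : 0 ≤ x := le_of_lt hx
    have hsq : (x * Real.cos θ) ^ 2 + (x * Real.sin θ) ^ 2 = x ^ 2 := by
      have := Real.cos_sq_add_sin_sq θ
      linear_combination x ^ 2 * this
    simp only [polarCoord_symm_apply, Set.indicator, Set.mem_ofPred_eq, hsq, Set.mem_Iic,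
      sq_le_sq₀ hx0 hr]
    split_ifs
    · rw [gaussianPDF, gaussianPDF, ← ENNReal.ofReal_mul (gaussianPDFReal_nonneg ..), smul_eq_mul,
        ← ENNReal.ofReal_mul hx0, ← ENNReal.ofReal_mul (by positivity)]
      congr 1
      simp only [gaussianPDFReal, NNReal.coe_one, mul_one, sub_zero]
      rw [mul_mul_mul_comm, ← mul_inv, Real.mul_self_sqrt (by positivity), ← Real.exp_add,
        ← add_div, ← neg_add, hsq]
      ring
    · simp
  rw [setLIntegral_congr_fun (measurableSet_Ioi.prod measurableSet_Ioo) hfun,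
    Measure.volume_eq_prod, ← Measure.prod_restrict,
    lintegral_prod_mul (f := (Set.Iic r).indicator _) (g := fun _ => ENNReal.ofReal _)]
  · rw [lintegral_indicator measurableSet_Iic, Measure.restrict_restrict measurableSet_Iic,
      Set.Iic_inter_Ioi, hint, lintegral_const, Measure.restrict_apply_univ, Real.volume_Ioo,
      ← ENNReal.ofReal_mul (by positivity)]
    rw [show (2 * Real.pi)⁻¹ * (Real.pi - -Real.pi) = 1 by field_simp; ring]
    simp
  · exact ((Measurable.ennreal_ofReal (by fun_prop)).indicator measurableSet_Iic).aemeasurable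
  · exact aemeasurable_const

/-- The law of a vector of independent standard complex Gaussians. -/
noncomputable def gaussianVector (d : ℕ) : Measure (Fin d → ℂ) :=
  Measure.pi fun _ => stdGaussian ℂ

instance (d : ℕ) : IsProbabilityMeasure (gaussianVector d) := by
  unfold gaussianVector; infer_instance

/-- Links the product description, suited to maxima, with the Euclidean one, suited to rotations. -/
lemma map_toLp_gaussianVector (d : ℕ) :
    (gaussianVector d).map (WithLp.toLp 2) = stdGaussian (EuclideanSpace ℂ (Fin d)) := by
  apply Measure.ext_of_charFun
  ext t
  rw [gaussianVector, charFun_stdGaussian, charFun_pi]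
  simp_rw [charFun_stdGaussian, ← Complex.exp_sum, ← Complex.ofReal_pow,
    EuclideanSpace.norm_sq_eq]
  simp [Finset.sum_div, neg_div]

lemma sum_norm_sq_eq_dotProduct {d : ℕ} (z : Fin d → ℂ) :
    ((∑ i, ‖z i‖ ^ 2 : ℝ) : ℂ) = star z ⬝ᵥ z := by
  simp [dotProduct, Complex.conj_mul']

lemma sum_norm_sq_mulVec {d : ℕ} (U : unitaryGroup (Fin d) ℂ) (z : Fin d → ℂ) :
    ∑ i, ‖(U.1 *ᵥ z) i‖ ^ 2 = ∑ i, ‖z i‖ ^ 2 := by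
  apply Complex.ofReal_injective
  rw [sum_norm_sq_eq_dotProduct, sum_norm_sq_eq_dotProduct, star_mulVec, dotProduct_mulVec,
    vecMul_vecMul, ← star_eq_conjTranspose, UnitaryGroup.star_mul_self, vecMul_one]

lemma star_mulVec_mulVec {d : ℕ} (U : unitaryGroup (Fin d) ℂ) (z : Fin d → ℂ) :
    star U.1 *ᵥ (U.1 *ᵥ z) = z := by
  rw [mulVec_mulVec, UnitaryGroup.star_mul_self, one_mulVec]

/-- A unitary matrix as a real linear isometry of Euclidean space. -/
noncomputable def unitaryIsometry {d : ℕ} (U : unitaryGroup (Fin d) ℂ) :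
    EuclideanSpace ℂ (Fin d) ≃ₗᵢ[ℝ] EuclideanSpace ℂ (Fin d) where
  toFun z := WithLp.toLp 2 (U.1 *ᵥ WithLp.ofLp z)
  invFun z := WithLp.toLp 2 (star U.1 *ᵥ WithLp.ofLp z)
  map_add' x y := by simp [mulVec_add]
  map_smul' c x := by simp [mulVec_smul]
  left_inv z := by simp
  right_inv z := by simp
  norm_map' z := by
    rw [← sq_eq_sq₀ (norm_nonneg _) (norm_nonneg _), EuclideanSpace.norm_sq_eq,
      EuclideanSpace.norm_sq_eq]
    exact sum_norm_sq_mulVec U _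

lemma map_mulVec_gaussianVector {d : ℕ} (U : unitaryGroup (Fin d) ℂ) :
    (gaussianVector d).map (fun z => U.1 *ᵥ z) = gaussianVector d := by
  apply (MeasurableEquiv.toLp 2 (Fin d → ℂ)).map_measurableEquiv_injective
  have h := stdGaussian_map (unitaryIsometry U)
  have hU : Measurable fun z : Fin d → ℂ => U.1 *ᵥ z :=
    (Continuous.matrix_mulVec continuous_const continuous_id).measurable
  have hI : Measurable (unitaryIsometry U) := (unitaryIsometry U).continuous.measurable
  rw [Measure.map_map (MeasurableEquiv.measurable _) hU, MeasurableEquiv.coe_toLp]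
  rw [← map_toLp_gaussianVector, Measure.map_map hI (by fun_prop)] at h
  exact h

/-- `∫ (1 - (1 - e^{-s/2})^n) ds = 2 H_n`. -/
lemma integral_one_sub_pow (n : ℕ) :
    IntegrableOn (fun s : ℝ => 1 - (1 - Real.exp (-s / 2)) ^ n) (Set.Ioi 0) ∧
    ∫ s in Set.Ioi (0 : ℝ), (1 - (1 - Real.exp (-s / 2)) ^ n) = 2 * (harmonic n : ℝ) := by
  induction n with
  | zero => simp
  | succ n ih =>
    -- Raising the exponent from `n` to `n + 1` adds `(1 - e^{-s/2})^n e^{-s/2}` to the integrand.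
    -- This is its primitive, contributing `2 / (n + 1)`.
    have hderiv : ∀ s ∈ Set.Ici (0 : ℝ), HasDerivAt
        (fun s : ℝ => 2 / (n + 1) * (1 - Real.exp (-s / 2)) ^ (n + 1))
        ((1 - Real.exp (-s / 2)) ^ n * Real.exp (-s / 2)) s := by
      intro s _
      have := (((((hasDerivAt_id s).neg.div_const 2).exp).const_sub 1).pow (n + 1)).const_mul
        (2 / (n + 1 : ℝ))
      refine this.congr_deriv ?_
      simp
      field_simp
    have hpos : ∀ s ∈ Set.Ioi (0 : ℝ), 0 ≤ (1 - Real.exp (-s / 2)) ^ n * Real.exp (-s / 2) := by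
      intro s hs
      have : Real.exp (-s / 2) ≤ 1 := Real.exp_le_one_iff.2 (by have : 0 < s := hs; linarith)
      have := sub_nonneg.2 this
      positivity
    have hlim : Filter.Tendsto (fun s : ℝ => 2 / (n + 1) * (1 - Real.exp (-s / 2)) ^ (n + 1))
        Filter.atTop (nhds (2 / (n + 1) * (1 - 0) ^ (n + 1))) := by
      refine ((tendsto_const_nhds.sub (Real.tendsto_exp_atBot.comp ?_)).pow _).const_mul _
      exact Filter.tendsto_neg_atTop_atBot.atBot_div_const two_pos
    have h1 := integrableOn_Ioi_deriv_of_nonneg' hderiv hpos hlim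
    have h2 := integral_Ioi_of_hasDerivAt_of_nonneg' hderiv hpos hlim
    have heq : (fun s : ℝ => 1 - (1 - Real.exp (-s / 2)) ^ (n + 1)) = fun s =>
        (1 - (1 - Real.exp (-s / 2)) ^ n) + (1 - Real.exp (-s / 2)) ^ n * Real.exp (-s / 2) := by
      ext s; ring
    rw [heq]
    refine ⟨ih.1.add h1, ?_⟩
    rw [integral_add ih.1 h1, ih.2, h2, harmonic_succ]
    push_cast
    simp
    field_simp

/-- Layer-cake formula: a sup-norm ball is a product of discs, so `‖z‖² ≤ s` has probability `(1 -
e^{-s/2})^d`. -/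
lemma lintegral_norm_sq_gaussianVector (d : ℕ) :
    ∫⁻ z, ENNReal.ofReal (‖z‖ ^ 2) ∂gaussianVector d = ENNReal.ofReal (2 * harmonic d) := by
  rw [lintegral_eq_lintegral_meas_lt _ (.of_forall fun _ => sq_nonneg _) (by fun_prop),
    ← (integral_one_sub_pow d).2, ofReal_integral_eq_lintegral_ofReal (integral_one_sub_pow d).1]
  · refine setLIntegral_congr_fun measurableSet_Ioi fun s hs => ?_
    have hs0 : 0 ≤ s := le_of_lt hs
    have hset : {z : Fin d → ℂ | s < ‖z‖ ^ 2} = (Metric.closedBall 0 √s)ᶜ := by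
      ext z
      rw [Set.mem_compl_iff, mem_closedBall_zero_iff, not_le, Real.sqrt_lt hs0 (norm_nonneg _)]
      rfl
    have hexp : 0 ≤ 1 - Real.exp (-s / 2) :=
      sub_nonneg.2 (Real.exp_le_one_iff.2 (by linarith))
    rw [hset, prob_compl_eq_one_sub measurableSet_closedBall, gaussianVector,
      Measure.pi_closedBall _ _ (Real.sqrt_nonneg s)]
    simp only [Pi.zero_apply, stdGaussian_complex_closedBall (Real.sqrt_nonneg s),
      Real.sq_sqrt hs0, Finset.prod_const, Finset.card_univ, Fintype.card_fin]
    rw [← ENNReal.ofReal_pow hexp, ENNReal.ofReal_sub _ (by positivity), ENNReal.ofReal_one]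
  · filter_upwards [ae_restrict_mem measurableSet_Ioi] with s hs
    have hs0 : 0 < s := hs
    have h1 : 0 ≤ 1 - Real.exp (-s / 2) := sub_nonneg.2 (Real.exp_le_one_iff.2 (by linarith))
    have h2 := Real.exp_pos (-s / 2)
    exact sub_nonneg.2 (pow_le_one₀ h1 (by linarith))

lemma integrable_norm_sq_gaussianVector (d : ℕ) :
    Integrable (fun z => ‖z‖ ^ 2) (gaussianVector d) := by
  refine ⟨by fun_prop, ?_⟩
  rw [hasFiniteIntegral_iff_ofReal (.of_forall fun _ => sq_nonneg _),
    lintegral_norm_sq_gaussianVector]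
  exact ENNReal.ofReal_lt_top

lemma integral_norm_sq_gaussianVector (d : ℕ) :
    ∫ z, ‖z‖ ^ 2 ∂gaussianVector d = 2 * harmonic d := by
  rw [integral_eq_lintegral_of_nonneg_ae (.of_forall fun _ => sq_nonneg _) (by fun_prop),
    lintegral_norm_sq_gaussianVector, ENNReal.toReal_ofReal]
  have : (0 : ℚ) ≤ harmonic d := Finset.sum_nonneg fun _ _ => by positivity
  exact_mod_cast mul_nonneg zero_le_two this

/-- A single coordinate is the case `d = 1` of the maximum, where `H_1 = 1`. -/
lemma integral_norm_apply_sq_gaussianVector {d : ℕ} (i : Fin d) :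
    ∫ z, ‖z i‖ ^ 2 ∂gaussianVector d = 2 := by
  have h1 : (gaussianVector d).map (Function.eval i) = stdGaussian ℂ :=
    (measurePreserving_eval (fun _ : Fin d => stdGaussian ℂ) i).map_eq
  have h2 : (gaussianVector 1).map (Function.eval 0) = stdGaussian ℂ :=
    (measurePreserving_eval (fun _ : Fin 1 => stdGaussian ℂ) 0).map_eq
  have h3 := integral_norm_sq_gaussianVector 1
  have h4 : ∀ z : Fin 1 → ℂ, ‖z‖ = ‖z 0‖ := fun z => by
    simp [Pi.norm_def]
  have e1 := integral_map (μ := gaussianVector d) (φ := Function.eval i) (f := fun z : ℂ => ‖z‖ ^ 2)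
    (measurable_pi_apply _).aemeasurable (by fun_prop)
  have e2 := integral_map (μ := gaussianVector 1) (φ := Function.eval 0) (f := fun z : ℂ => ‖z‖ ^ 2)
    (measurable_pi_apply _).aemeasurable (by fun_prop)
  simp_rw [h4] at h3
  rw [h1] at e1
  rw [h2] at e2
  simp only [Function.eval] at e1 e2
  rw [← e1, e2, h3]
  norm_num [harmonic]

lemma integral_mulVec_gaussianVector {d : ℕ} (U : unitaryGroup (Fin d) ℂ) (f : (Fin d → ℂ) → ℂ)
    (hf : Measurable f) :
    ∫ z, f (U.1 *ᵥ z) ∂gaussianVector d = ∫ z, f z ∂gaussianVector d := by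
  have hU : Measurable fun z : Fin d → ℂ => U.1 *ᵥ z :=
    (Continuous.matrix_mulVec continuous_const continuous_id).measurable
  conv_rhs => rw [← map_mulVec_gaussianVector U]
  rw [integral_map hU.aemeasurable hf.aestronglyMeasurable]

lemma integral_comp_perm_gaussianVector {d : ℕ} (σ : Equiv.Perm (Fin d)) (f : (Fin d → ℂ) → ℂ) :
    ∫ z, f (z ∘ σ) ∂gaussianVector d = ∫ z, f z ∂gaussianVector d := by
  have h := measurePreserving_piCongrLeft (fun _ : Fin d => stdGaussian ℂ) σ.symm
  have h2 := h.integral_comp (MeasurableEquiv.measurableEmbedding _) f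
  rw [← gaussianVector] at h2
  rw [← h2]
  congr with z
  congr 1
  ext i
  rw [← σ.symm_apply_apply i]
  simp [-Equiv.symm_apply_apply, MeasurableEquiv.piCongrLeft, Equiv.piCongrLeft_apply_apply]

/-! ### Weighted Gaussian averages of `|z⟩⟨z|` -/

/-- A measurable weight with values in `[-1, 1]`. -/
structure IsWeight {d : ℕ} (w : (Fin d → ℂ) → ℝ) : Prop where
  measurable : Measurable w
  abs_le_one : ∀ z, |w z| ≤ 1

/-- The matrix `∫ w(z) |z⟩⟨z| γ(dz) / 2`. -/
noncomputable def gaussMatrix {d : ℕ} (w : (Fin d → ℂ) → ℝ) : Matrix (Fin d) (Fin d) ℂ :=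
  of fun i j => ∫ z, ((w z / 2 : ℝ) : ℂ) * (z i * star (z j)) ∂gaussianVector d

lemma IsWeight.integrable {d : ℕ} {w : (Fin d → ℂ) → ℝ} (hw : IsWeight w) (i j : Fin d) :
    Integrable (fun z => ((w z / 2 : ℝ) : ℂ) * (z i * star (z j))) (gaussianVector d) := by
  have := hw.measurable
  refine (integrable_norm_sq_gaussianVector d).mono' (by fun_prop) (.of_forall fun z => ?_)
  rw [norm_mul, norm_mul, norm_star, Complex.norm_real, Real.norm_eq_abs, abs_div, abs_two]
  have h1 := norm_le_pi_norm z i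
  have h2 := norm_le_pi_norm z j
  have h3 := hw.abs_le_one z
  calc |w z| / 2 * (‖z i‖ * ‖z j‖) ≤ 1 * (‖z‖ * ‖z‖) := by gcongr; linarith [abs_nonneg (w z)]
    _ = ‖z‖ ^ 2 := by ring

lemma IsWeight.one {d : ℕ} : IsWeight (fun _ : Fin d → ℂ => 1) := ⟨measurable_const, by simp⟩

lemma IsWeight.comp_mulVec {d : ℕ} {w : (Fin d → ℂ) → ℝ} (hw : IsWeight w)
    (U : Matrix (Fin d) (Fin d) ℂ) : IsWeight (fun z => w (U *ᵥ z)) :=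
  ⟨hw.measurable.comp (Continuous.matrix_mulVec continuous_const continuous_id).measurable,
    fun _ => hw.abs_le_one _⟩

lemma gaussMatrix_apply {d : ℕ} (w : (Fin d → ℂ) → ℝ) (i j : Fin d) :
    gaussMatrix w i j = ∫ z, ((w z / 2 : ℝ) : ℂ) * (z i * star (z j)) ∂gaussianVector d := rfl

lemma gaussMatrix_sum {d : ℕ} {ι : Type*} (s : Finset ι) (w : ι → (Fin d → ℂ) → ℝ)
    (hw : ∀ i ∈ s, IsWeight (w i)) :
    gaussMatrix (fun z => ∑ i ∈ s, w i z) = ∑ i ∈ s, gaussMatrix (w i) := by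
  ext a b
  rw [Matrix.sum_apply]
  simp only [gaussMatrix_apply]
  rw [← integral_finsetSum _ fun i hi => (hw i hi).integrable a b]
  simp [Finset.sum_div, Finset.sum_mul]

lemma integral_mul_normSq {d : ℕ} {w : (Fin d → ℂ) → ℝ} (hw : IsWeight w) (ψ : Fin d → ℂ) :
    Integrable (fun z => w z * (‖star ψ ⬝ᵥ z‖ ^ 2 / 2)) (gaussianVector d) ∧
    star ψ ⬝ᵥ (gaussMatrix w *ᵥ ψ) =
      ((∫ z, w z * (‖star ψ ⬝ᵥ z‖ ^ 2 / 2) ∂gaussianVector d : ℝ) : ℂ) := by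
  have hterm (i j : Fin d) := ((hw.integrable i j).const_mul (star (ψ i) * ψ j))
  have hexp : ∀ z, ((w z * (‖star ψ ⬝ᵥ z‖ ^ 2 / 2) : ℝ) : ℂ) =
      ∑ i, ∑ j, star (ψ i) * ψ j * (((w z / 2 : ℝ) : ℂ) * (z i * star (z j))) := by
    intro z
    push_cast
    rw [← Complex.mul_conj', dotProduct, map_sum, Finset.sum_mul_sum, Finset.sum_div,
      Finset.mul_sum]
    refine Finset.sum_congr rfl fun i _ => ?_
    rw [Finset.sum_div, Finset.mul_sum]
    refine Finset.sum_congr rfl fun j _ => ?_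
    simp
    ring
  have hint : Integrable (fun z => ((w z * (‖star ψ ⬝ᵥ z‖ ^ 2 / 2) : ℝ) : ℂ))
      (gaussianVector d) := by
    simp_rw [hexp]
    exact integrable_finsetSum _ fun i _ => integrable_finsetSum _ fun j _ => hterm i j
  refine ⟨hint.re, ?_⟩
  rw [← integral_complex_ofReal]
  simp_rw [hexp]
  rw [integral_finsetSum _ fun i _ => integrable_finsetSum _ fun j _ => hterm i j, dotProduct]
  refine Finset.sum_congr rfl fun i _ => ?_
  rw [integral_finsetSum _ fun j _ => hterm i j, mulVec, dotProduct, Finset.mul_sum]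
  refine Finset.sum_congr rfl fun j _ => ?_
  rw [integral_const_mul, gaussMatrix_apply, Pi.star_apply]
  ring

lemma gaussMatrix_posSemidef {d : ℕ} {w : (Fin d → ℂ) → ℝ} (hw : IsWeight w) (h0 : ∀ z, 0 ≤ w z) :
    (gaussMatrix w).PosSemidef := by
  rw [posSemidef_iff_dotProduct_mulVec]
  refine ⟨?_, fun ψ => ?_⟩
  · ext i j
    rw [conjTranspose_apply, gaussMatrix_apply, gaussMatrix_apply]
    change (starRingEnd ℂ) _ = _
    rw [← integral_conj]
    congr with z
    rw [map_mul, Complex.conj_ofReal, map_mul, starRingEnd_apply, starRingEnd_apply, star_star,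
      mul_comm (star _)]
  · rw [(integral_mul_normSq hw ψ).2]
    exact_mod_cast integral_nonneg fun z => mul_nonneg (h0 z) (by positivity)

/-- Substitute `z ↦ Uz`, which preserves the Gaussian law and conjugates `|z⟩⟨z|` by `U`. -/
lemma gaussMatrix_comp_mulVec {d : ℕ} {w : (Fin d → ℂ) → ℝ} (hw : IsWeight w)
    (U : unitaryGroup (Fin d) ℂ) :
    gaussMatrix (fun z => w (star U.1 *ᵥ z)) = U.1 * gaussMatrix w * star U.1 := by
  ext i j
  have hm := hw.measurable
  rw [gaussMatrix_apply, ← integral_mulVec_gaussianVector U]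
  swap
  · have := (hw.comp_mulVec (star U.1)).measurable
    fun_prop
  simp only [star_mulVec_mulVec]
  have hexp : ∀ z : Fin d → ℂ, ((w z / 2 : ℝ) : ℂ) * ((U.1 *ᵥ z) i * star ((U.1 *ᵥ z) j)) =
      ∑ l, ∑ k, U.1 i k * star (U.1 j l) * (((w z / 2 : ℝ) : ℂ) * (z k * star (z l))) := by
    intro z
    simp only [mulVec, dotProduct, star_sum]
    rw [Finset.sum_mul_sum, Finset.sum_comm, Finset.mul_sum]
    refine Finset.sum_congr rfl fun i _ => ?_
    rw [Finset.mul_sum]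
    refine Finset.sum_congr rfl fun j _ => ?_
    simp
    ring
  have hterm (k l : Fin d) := ((hw.integrable k l).const_mul (U.1 i k * star (U.1 j l)))
  simp_rw [hexp]
  rw [integral_finsetSum _ fun l _ => integrable_finsetSum _ fun k _ => hterm k l, mul_apply]
  refine Finset.sum_congr rfl fun l _ => ?_
  rw [integral_finsetSum _ fun k _ => hterm k l, mul_apply, Finset.sum_mul]
  refine Finset.sum_congr rfl fun k _ => ?_
  rw [integral_const_mul, gaussMatrix_apply, star_apply]
  ring

/-- The diagonal unitary that flips the sign of one coordinate. -/
noncomputable def signFlip {d : ℕ} (k : Fin d) : unitaryGroup (Fin d) ℂ :=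
  ⟨diagonal fun i => if i = k then -1 else 1, by
    rw [mem_unitaryGroup_iff, star_eq_conjTranspose, diagonal_conjTranspose, diagonal_mul_diagonal,
      ← diagonal_one]
    congr 1
    ext i
    by_cases h : i = k <;> simp [h]⟩

/-- Flipping the sign of coordinate `i` fixes `w`, so by covariance the entry equals its own
negative. -/
lemma gaussMatrix_offDiag {d : ℕ} {w : (Fin d → ℂ) → ℝ} (hw : IsWeight w)
    (hinv : ∀ z z' : Fin d → ℂ, (∀ i, ‖z i‖ = ‖z' i‖) → w z = w z') {i j : Fin d} (hij : i ≠ j) :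
    gaussMatrix w i j = 0 := by
  have h := congrFun₂ (gaussMatrix_comp_mulVec hw (signFlip i)) i j
  have h2 : (fun z => w (star (signFlip i).1 *ᵥ z)) = w := by
    ext z
    apply hinv
    intro k
    simp only [signFlip, star_eq_conjTranspose, diagonal_conjTranspose, mulVec_diagonal]
    by_cases hk : k = i <;> simp [hk]
  rw [h2] at h
  simp only [signFlip, star_eq_conjTranspose, diagonal_conjTranspose, mul_diagonal,
    diagonal_mul] at h
  simp [hij.symm] at h
  exact self_eq_neg.1 h

lemma gaussMatrix_diag {d : ℕ} (w : (Fin d → ℂ) → ℝ) (i : Fin d) :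
    gaussMatrix w i i = ((∫ z, w z * (‖z i‖ ^ 2 / 2) ∂gaussianVector d : ℝ) : ℂ) := by
  rw [gaussMatrix_apply, ← integral_complex_ofReal]
  congr with z
  rw [← starRingEnd_apply, Complex.mul_conj']
  push_cast
  ring

lemma gaussMatrix_one {d : ℕ} : gaussMatrix (fun _ : Fin d → ℂ => 1) = 1 := by
  ext i j
  by_cases hij : i = j
  · subst hij
    simp [gaussMatrix_diag, integral_div, integral_norm_apply_sq_gaussianVector]
  · rw [gaussMatrix_offDiag .one (by simp) hij, one_apply_ne hij]

/-! ### The largest-coordinate response -/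

/-- The indices of the coordinates of maximal modulus. -/
noncomputable def argmax {d : ℕ} (z : Fin d → ℂ) : Finset (Fin d) :=
  Finset.univ.filter fun i => ‖z i‖ = ‖z‖

/-- The uniform distribution on the coordinates of maximal modulus. -/
noncomputable def maxWeight {d : ℕ} (x : Fin d) (z : Fin d → ℂ) : ℝ :=
  if ‖z x‖ = ‖z‖ then ((argmax z).card : ℝ)⁻¹ else 0

lemma maxWeight_nonneg {d : ℕ} (x : Fin d) (z : Fin d → ℂ) : 0 ≤ maxWeight x z := by
  unfold maxWeight
  split_ifs <;> positivity

lemma argmax_nonempty {d : ℕ} [NeZero d] (z : Fin d → ℂ) : (argmax z).Nonempty := by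
  obtain ⟨i, hi⟩ := Finite.exists_max fun i => ‖z i‖
  refine ⟨i, ?_⟩
  simp only [argmax, Finset.mem_filter, Finset.mem_univ, true_and]
  exact le_antisymm (norm_le_pi_norm z i) ((pi_norm_le_iff_of_nonneg (norm_nonneg _)).2 hi)

/-- Sharing the weight among ties gives normalisation at every `z`, not just almost everywhere, as a
post-processing requires. -/
lemma sum_maxWeight {d : ℕ} [NeZero d] (z : Fin d → ℂ) : ∑ x, maxWeight x z = 1 := by
  simp only [maxWeight]
  rw [← Finset.sum_filter, Finset.sum_const, nsmul_eq_mul]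
  exact mul_inv_cancel₀ (Nat.cast_ne_zero.2 (argmax_nonempty z).card_pos.ne')

lemma sum_maxWeight_mul {d : ℕ} [NeZero d] (z : Fin d → ℂ) :
    ∑ x, maxWeight x z * (‖z x‖ ^ 2 / 2) = ‖z‖ ^ 2 / 2 := by
  rw [← one_mul (‖z‖ ^ 2 / 2), ← sum_maxWeight z, Finset.sum_mul]
  refine Finset.sum_congr rfl fun x _ => ?_
  by_cases h : ‖z x‖ = ‖z‖
  · rw [h]
  · simp [maxWeight, h]

lemma isWeight_maxWeight {d : ℕ} (x : Fin d) : IsWeight (maxWeight x) := by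
  have hset : ∀ i : Fin d, MeasurableSet {z : Fin d → ℂ | ‖z i‖ = ‖z‖} := fun i =>
    measurableSet_eq_fun (by fun_prop) (by fun_prop)
  constructor
  · refine Measurable.ite (hset x) (Measurable.inv ?_) measurable_const
    have : (fun z : Fin d → ℂ => ((argmax z).card : ℝ)) =
        fun z => ∑ i, if ‖z i‖ = ‖z‖ then 1 else 0 := by
      ext z
      simp [argmax]
    rw [this]
    exact Finset.measurable_sum _ fun i _ =>
      Measurable.ite (hset i) measurable_const measurable_const
  · intro z
    rw [abs_of_nonneg (maxWeight_nonneg x z)]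
    unfold maxWeight
    split_ifs
    · exact Nat.cast_inv_le_one _
    · exact zero_le_one

lemma maxWeight_congr {d : ℕ} (x : Fin d) {z z' : Fin d → ℂ} (h : ∀ i, ‖z i‖ = ‖z' i‖) :
    maxWeight x z = maxWeight x z' := by
  have hn : ‖z‖ = ‖z'‖ := by
    simp only [Pi.norm_def, nnnorm]
    simp [h]
  simp [maxWeight, argmax, h, hn]

lemma norm_comp_perm {d : ℕ} (σ : Equiv.Perm (Fin d)) (z : Fin d → ℂ) : ‖z ∘ σ‖ = ‖z‖ := by
  apply le_antisymm <;> rw [pi_norm_le_iff_of_nonneg (norm_nonneg _)] <;> intro i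
  · exact norm_le_pi_norm z _
  · simpa using norm_le_pi_norm (z ∘ σ) (σ.symm i)

lemma maxWeight_comp_perm {d : ℕ} (σ : Equiv.Perm (Fin d)) (x : Fin d) (z : Fin d → ℂ) :
    maxWeight x (z ∘ σ) = maxWeight (σ x) z := by
  have : (argmax (z ∘ σ)).card = (argmax z).card := by
    refine Finset.card_bij (fun i _ => σ i) ?_ (fun _ _ _ _ h => σ.injective h) ?_
    · intro i hi
      simpa [argmax, norm_comp_perm] using hi
    · intro i hi
      exact ⟨σ.symm i, by simpa [argmax, norm_comp_perm] using hi, by simp⟩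
  simp [maxWeight, norm_comp_perm, this]

lemma gaussMatrix_maxWeight_perm {d : ℕ} (σ : Equiv.Perm (Fin d)) (x i : Fin d) :
    gaussMatrix (maxWeight (σ x)) (σ i) (σ i) = gaussMatrix (maxWeight x) i i := by
  rw [gaussMatrix_apply, gaussMatrix_apply]
  conv_rhs => rw [← integral_comp_perm_gaussianVector σ]
  simp_rw [maxWeight_comp_perm]
  rfl

lemma trace_gaussMatrix_maxWeight {d : ℕ} [NeZero d] :
    ∑ x : Fin d, gaussMatrix (maxWeight x) x x = ((harmonic d : ℝ) : ℂ) := by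
  have hint : ∀ x ∈ Finset.univ, Integrable (fun z => maxWeight x z * (‖z x‖ ^ 2 / 2))
      (gaussianVector d) := by
    intro x _
    have := (integral_mul_normSq (isWeight_maxWeight x) (Pi.single x 1)).1
    simpa [← Pi.single_star] using this
  simp_rw [gaussMatrix_diag]
  rw [← Complex.ofReal_sum, ← integral_finsetSum _ hint]
  simp_rw [sum_maxWeight_mul]
  rw [integral_div, integral_norm_sq_gaussianVector]
  simp

/-- By permutation symmetry the `d` entries are equal, and they add up to the mean `H_d` of the
maximum. -/
lemma gaussMatrix_maxWeight_self {d : ℕ} [NeZero d] (x : Fin d) :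
    gaussMatrix (maxWeight x) x x = ((harmonic d / d : ℝ) : ℂ) := by
  have h : ∀ y : Fin d, gaussMatrix (maxWeight y) y y = gaussMatrix (maxWeight x) x x := by
    intro y
    simpa using gaussMatrix_maxWeight_perm (Equiv.swap x y) x x
  have ht := trace_gaussMatrix_maxWeight (d := d)
  simp_rw [h] at ht
  rw [Finset.sum_const, Finset.card_univ, Fintype.card_fin, nsmul_eq_mul] at ht
  have hd : (d : ℂ) ≠ 0 := Nat.cast_ne_zero.2 (NeZero.ne d)
  push_cast at ht ⊢
  rw [← ht]
  field_simp

/-- For fixed `i` the entries sum to 1 over all outcomes. The outcome `i` takes `H_d / d`, and the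
other `d - 1` share the rest equally by symmetry. -/
lemma gaussMatrix_maxWeight_ne {d : ℕ} [NeZero d] (hd : 2 ≤ d) {x i : Fin d} (hxi : x ≠ i) :
    gaussMatrix (maxWeight x) i i = (((1 - threshold d) / d : ℝ) : ℂ) := by
  have h : ∀ y : Fin d, y ≠ i → gaussMatrix (maxWeight y) i i = gaussMatrix (maxWeight x) i i := by
    intro y hy
    simpa [Equiv.swap_apply_of_ne_of_ne hxi.symm hy.symm] using
      gaussMatrix_maxWeight_perm (Equiv.swap x y) x i
  have hs : ∑ y, gaussMatrix (maxWeight y) i i = 1 := by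
    rw [← Matrix.sum_apply, ← gaussMatrix_sum _ _ fun y _ => isWeight_maxWeight y]
    simp [sum_maxWeight, gaussMatrix_one]
  rw [← Finset.add_sum_erase _ _ (Finset.mem_univ i), gaussMatrix_maxWeight_self,
    Finset.sum_congr rfl fun y hy => h y (Finset.ne_of_mem_erase hy), Finset.sum_const,
    Finset.card_erase_of_mem (Finset.mem_univ i), Finset.card_univ, Fintype.card_fin,
    nsmul_eq_mul, Nat.cast_sub (by omega)] at hs
  have hd0 : (d : ℂ) ≠ 0 := Nat.cast_ne_zero.2 (NeZero.ne d)
  have hd1 : (d : ℂ) - 1 ≠ 0 := sub_ne_zero.2 (by exact_mod_cast (by omega : d ≠ 1))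
  unfold threshold
  push_cast at hs ⊢
  field_simp at hs ⊢
  linear_combination hs

/-! ### From the standard basis to arbitrary PVMs -/

/-- The rank-one projection on the `i`-th column of a unitary matrix. -/
noncomputable def basisProj {d : ℕ} (U : unitaryGroup (Fin d) ℂ) (i : Fin d) :
    Matrix (Fin d) (Fin d) ℂ :=
  U.1 * single i i 1 * star U.1

lemma trace_basisProj {d : ℕ} (U : unitaryGroup (Fin d) ℂ) (i : Fin d) :
    (basisProj U i).trace = 1 := by
  rw [basisProj, trace_mul_comm, ← mul_assoc, UnitaryGroup.star_mul_self, one_mul]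
  simp

lemma gaussMatrix_maxWeight_comp {d : ℕ} (hd : 2 ≤ d) (U : unitaryGroup (Fin d) ℂ) (x : Fin d) :
    gaussMatrix (fun z => maxWeight x (star U.1 *ᵥ z)) =
      noisy (threshold d) (basisProj U) x := by
  have : NeZero d := ⟨by omega⟩
  have hd0 : (d : ℂ) ≠ 0 := Nat.cast_ne_zero.2 (NeZero.ne d)
  have hd1 : (d : ℂ) - 1 ≠ 0 := sub_ne_zero.2 (by exact_mod_cast (by omega : d ≠ 1))
  have hM : gaussMatrix (maxWeight x) = (threshold d : ℂ) • single x x 1 +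
      (((1 - threshold d : ℝ) : ℂ) / (d : ℂ)) • 1 := by
    ext i j
    by_cases hij : i = j
    · subst hij
      by_cases hxi : x = i
      · subst hxi
        rw [gaussMatrix_maxWeight_self]
        simp [threshold]
        field_simp
        ring
      · rw [gaussMatrix_maxWeight_ne hd hxi]
        simp [hxi]
    · rw [gaussMatrix_offDiag (isWeight_maxWeight x) (fun _ _ h => maxWeight_congr x h) hij]
      have : ¬ (x = i ∧ x = j) := fun h => hij (h.1.symm.trans h.2)
      simp [hij, this]
  rw [gaussMatrix_comp_mulVec (isWeight_maxWeight x), hM, noisy, trace_basisProj, basisProj,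
    mul_add, add_mul, Matrix.mul_smul, Matrix.smul_mul, Matrix.mul_smul, mul_one, Matrix.smul_mul,
    mem_unitaryGroup_iff.1 U.2, mul_one]

lemma IsPVM.mul_self {d : ℕ} {O : Type*} [Fintype O] {A : O → Matrix (Fin d) (Fin d) ℂ}
    (hA : IsPVM A) (x : O) : A x * A x = A x :=
  (hA.isStarProjection x).isIdempotentElem

lemma IsPVM.star_eq {d : ℕ} {O : Type*} [Fintype O] {A : O → Matrix (Fin d) (Fin d) ℂ}
    (hA : IsPVM A) (x : O) : (A x)ᴴ = A x :=
  (hA.isStarProjection x).isSelfAdjoint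

/-- The positive matrices `(A y A x)ᴴ (A y A x)` sum over `y` to `A x`, which is already the term `y
= x`. The others have total trace zero, hence vanish. -/
lemma IsPVM.mul_eq_zero {d : ℕ} {O : Type*} [Fintype O] {A : O → Matrix (Fin d) (Fin d) ℂ}
    (hA : IsPVM A) {x y : O} (hxy : y ≠ x) : A y * A x = 0 := by
  classical
  have hterm : ∀ y, (A y * A x)ᴴ * (A y * A x) = A x * A y * A x := fun y => by
    rw [conjTranspose_mul, hA.star_eq, hA.star_eq, mul_assoc, ← mul_assoc (A y), hA.mul_self,
      mul_assoc]
  have h : ∑ y, (A y * A x)ᴴ * (A y * A x) = A x := by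
    simp_rw [hterm]
    rw [← Finset.sum_mul, ← Finset.mul_sum, hA.sum_eq_one, mul_one, hA.mul_self]
  rw [← Finset.add_sum_erase _ _ (Finset.mem_univ x), hterm x, hA.mul_self, hA.mul_self,
    add_eq_left] at h
  have ht := congrArg trace h
  rw [trace_sum, trace_zero, Finset.sum_eq_zero_iff_of_nonneg
    fun y _ => (posSemidef_conjTranspose_mul_self _).trace_nonneg] at ht
  exact trace_conjTranspose_mul_self_eq_zero_iff.1
    (ht y (Finset.mem_erase.2 ⟨hxy, Finset.mem_univ _⟩))

open Classical in
/-- Every PVM is a coarse-graining of an orthonormal basis. -/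
lemma IsPVM.exists_basis {d : ℕ} {O : Type*} [Fintype O] {A : O → Matrix (Fin d) (Fin d) ℂ}
    (hA : IsPVM A) : ∃ (U : unitaryGroup (Fin d) ℂ) (f : Fin d → O),
      ∀ x, A x = ∑ i with f i = x, basisProj U i := by
  -- Distinct real labels turn the PVM into one Hermitian matrix `M`; its eigenbasis diagonalises
  -- every `A x`, and the eigenvalue identifies the outcome.
  let c : O → ℝ := fun x => ((Fintype.equivFin O x : ℕ) : ℝ)
  have hc : Function.Injective c := fun x y h =>
    (Fintype.equivFin O).injective (Fin.ext (Nat.cast_injective h))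
  let M : Matrix (Fin d) (Fin d) ℂ := ∑ x, (c x : ℂ) • A x
  have hM : M.IsHermitian := by
    rw [IsHermitian, conjTranspose_sum]
    simp [hA.star_eq, M]
  have hAM : ∀ x, A x * M = (c x : ℂ) • A x := by
    intro x
    rw [Finset.mul_sum, Finset.sum_eq_single x, Matrix.mul_smul, hA.mul_self]
    · intro y _ hy
      rw [Matrix.mul_smul, hA.mul_eq_zero hy.symm, smul_zero]
    · simp
  let U := hM.eigenvectorUnitary
  let B : O → Matrix (Fin d) (Fin d) ℂ := fun x => star U.1 * A x * U.1
  have hAB : ∀ x, A x = U.1 * B x * star U.1 := fun x => by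
    have := mem_unitaryGroup_iff.1 U.2
    simp only [B, ← mul_assoc]
    rw [this, one_mul, mul_assoc, this, mul_one]
  have hB1 : ∑ x, B x = 1 := by
    simp only [B]
    rw [← Finset.sum_mul, ← Finset.mul_sum, hA.sum_eq_one, mul_one, UnitaryGroup.star_mul_self]
  have hdiag : star U.1 * M * U.1 = diagonal (fun i => (hM.eigenvalues i : ℂ)) := by
    conv_lhs => rw [hM.spectral_theorem]
    rw [Unitary.conjStarAlgAut_apply]
    change star U.1 * (U.1 * _ * star U.1) * U.1 = _
    have := UnitaryGroup.star_mul_self U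
    simp only [← mul_assoc]
    rw [this, one_mul, mul_assoc, this, mul_one]
    rfl
  have hBD : ∀ x i j, B x i j * (hM.eigenvalues j : ℂ) = c x * B x i j := by
    intro x i j
    have h : B x * diagonal (fun i => (hM.eigenvalues i : ℂ)) = (c x : ℂ) • B x := by
      rw [← hdiag]
      calc star U.1 * A x * U.1 * (star U.1 * M * U.1)
          = star U.1 * (A x * (U.1 * star U.1) * M) * U.1 := by simp only [mul_assoc]
        _ = _ := by
          rw [mem_unitaryGroup_iff.1 U.2, mul_one, hAM, Matrix.mul_smul, Matrix.smul_mul]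
    simpa using congrFun₂ h i j
  have hB0 : ∀ x i j, c x ≠ hM.eigenvalues j → B x i j = 0 := by
    intro x i j h
    by_contra h0
    have := hBD x i j
    rw [mul_comm] at this
    exact h (by exact_mod_cast (mul_right_cancel₀ h0 this).symm)
  -- Otherwise column `j` would vanish in every `B x`, although these sum to the identity.
  have hex : ∀ j, ∃ x, c x = hM.eigenvalues j := by
    intro j
    by_contra! h
    have := congrFun₂ hB1 j j
    rw [Matrix.sum_apply, Finset.sum_eq_zero fun x _ => hB0 x j j (h x)] at this
    simp at this
  choose f hf using hex
  have hB : ∀ x, B x = ∑ i with f i = x, single i i 1 := by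
    intro x
    ext i j
    have hR : (∑ k with f k = x, single k k (1 : ℂ)) i j = if f j = x then (1 : Matrix _ _ ℂ) i j
        else 0 := by
      rw [Matrix.sum_apply]
      simp only [single_apply]
      rw [Finset.sum_filter, Finset.sum_eq_single j]
      · simp [one_apply, eq_comm]
      · intro k _ hk
        simp [hk]
      · simp
    rw [hR]
    split_ifs with h
    · rw [← hB1, Matrix.sum_apply, Finset.sum_eq_single x]
      · intro y _ hy
        refine hB0 y i j fun hy' => hy (hc ?_)
        rw [hy', ← hf, h]
      · simp
    · exact hB0 x i j fun hx => h (hc ((hf j).trans hx.symm))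
  refine ⟨U, f, fun x => ?_⟩
  rw [hAB, hB, Finset.mul_sum, Finset.sum_mul]
  rfl

lemma noisy_sum {d : ℕ} {O ι : Type*} (t : ℝ) {A : O → Matrix (Fin d) (Fin d) ℂ}
    {B : ι → Matrix (Fin d) (Fin d) ℂ} {x : O} {s : Finset ι} (h : A x = ∑ i ∈ s, B i) :
    noisy t A x = ∑ i ∈ s, noisy t B i := by
  simp only [noisy, h, trace_sum, Finset.sum_add_distrib, Finset.smul_sum, Finset.mul_sum,
    Finset.sum_smul]

open Classical in
/-- The response function for the coarse-graining along `f` of the basis `U`. -/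
noncomputable def response {d : ℕ} {O : Type*} (U : unitaryGroup (Fin d) ℂ) (f : Fin d → O) (x : O)
    (z : Fin d → ℂ) : ℝ :=
  ∑ i with f i = x, maxWeight i (star U.1 *ᵥ z)

lemma response_nonneg {d : ℕ} {O : Type*} (U : unitaryGroup (Fin d) ℂ) (f : Fin d → O) (x : O)
    (z : Fin d → ℂ) : 0 ≤ response U f x z :=
  Finset.sum_nonneg fun _ _ => maxWeight_nonneg _ _

lemma sum_response {d : ℕ} [NeZero d] {O : Type*} [Fintype O] (U : unitaryGroup (Fin d) ℂ)
    (f : Fin d → O) (z : Fin d → ℂ) : ∑ x, response U f x z = 1 := by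
  classical
  rw [← sum_maxWeight (star U.1 *ᵥ z)]
  exact Finset.sum_fiberwise Finset.univ f _

lemma response_le_one {d : ℕ} [NeZero d] {O : Type*} (U : unitaryGroup (Fin d) ℂ) (f : Fin d → O)
    (x : O) (z : Fin d → ℂ) : response U f x z ≤ 1 := by
  classical
  rw [← sum_maxWeight (star U.1 *ᵥ z)]
  exact Finset.sum_le_sum_of_subset_of_nonneg (Finset.filter_subset _ _)
    fun _ _ _ => maxWeight_nonneg _ _

lemma isWeight_response {d : ℕ} [NeZero d] {O : Type*} (U : unitaryGroup (Fin d) ℂ)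
    (f : Fin d → O) (x : O) : IsWeight (response U f x) :=
  ⟨Finset.measurable_sum _ fun i _ => ((isWeight_maxWeight i).comp_mulVec _).measurable, fun z => by
    rw [abs_of_nonneg (response_nonneg U f x z)]
    exact response_le_one U f x z⟩

lemma gaussMatrix_response {d : ℕ} (hd : 2 ≤ d) {O : Type*} {A : O → Matrix (Fin d) (Fin d) ℂ}
    (U : unitaryGroup (Fin d) ℂ) (f : Fin d → O) (x : O)
    (h : open Classical in A x = ∑ i with f i = x, basisProj U i) :
    gaussMatrix (response U f x) = noisy (threshold d) A x := by
  classical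
  rw [noisy_sum _ h]
  simp_rw [← gaussMatrix_maxWeight_comp hd]
  exact gaussMatrix_sum _ _ fun i _ => (isWeight_maxWeight i).comp_mulVec _

/-! ### The Gaussian parent POVM and joint measurability at the threshold -/

lemma isWeight_indicator {d : ℕ} {s : Set (Fin d → ℂ)} (hs : MeasurableSet s) :
    IsWeight (s.indicator fun _ => 1) := by
  refine ⟨measurable_const.indicator hs, fun z => ?_⟩
  by_cases h : z ∈ s <;> simp [h]

lemma gaussMatrix_indicator {d : ℕ} {s : Set (Fin d → ℂ)} (hs : MeasurableSet s) (i j : Fin d) :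
    gaussMatrix (s.indicator fun _ => 1) i j =
      ∫ z in s, ((1 / 2 : ℝ) : ℂ) * (z i * star (z j)) ∂gaussianVector d := by
  rw [gaussMatrix_apply, ← integral_indicator hs]
  congr with z
  by_cases h : z ∈ s <;> simp [h]

open Classical in
/-- The POVM `s ↦ ∫_s |z⟩⟨z| γ(dz) / 2`, where `γ` is the law of a Gaussian vector. -/
noncomputable def gaussPOVM (d : ℕ) : POVM d (ULift.{w} (Fin d → ℂ)) where
  toVectorMeasure :=
    { measureOf' := fun s => if MeasurableSet s then
        gaussMatrix ((ULift.up ⁻¹' s).indicator fun _ => 1) else 0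
      empty' := by
        ext i j
        simp [gaussMatrix_apply]
      not_measurable' := fun s hs => by simp [hs]
      m_iUnion' := fun f hf hd => by
        have hf' : ∀ n, MeasurableSet (ULift.up ⁻¹' f n) := fun n => measurable_up (hf n)
        simp only [hf, MeasurableSet.iUnion hf, if_true]
        refine Pi.hasSum.2 fun i => Pi.hasSum.2 fun j => ?_
        simp only [gaussMatrix_indicator (hf' _),
          gaussMatrix_indicator (MeasurableSet.iUnion hf'), Set.preimage_iUnion]
        exact hasSum_integral_iUnion hf' (fun a b hab => (hd hab).preimage _)
          (IsWeight.one.integrable i j).integrableOn }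
  posSemidef := fun s hs => by
    change (ite _ _ _ : Matrix (Fin d) (Fin d) ℂ).PosSemidef
    rw [if_pos hs]
    exact gaussMatrix_posSemidef (isWeight_indicator (measurable_up hs))
      fun z => Set.indicator_nonneg (fun _ _ => zero_le_one) z
  univ_eq_one := by
    change (ite _ _ _ : Matrix (Fin d) (Fin d) ℂ) = 1
    simp [gaussMatrix_one]

lemma gaussPOVM_apply {d : ℕ} {s : Set (ULift.{w} (Fin d → ℂ))} (hs : MeasurableSet s) :
    (gaussPOVM d).toVectorMeasure s = gaussMatrix ((ULift.up ⁻¹' s).indicator fun _ => 1) :=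
  if_pos hs

lemma bornMeasure_gaussPOVM {d : ℕ} (ψ : Fin d → ℂ) :
    (gaussPOVM.{w} d).bornMeasure ψ = ((gaussianVector d).withDensity
      fun z => ENNReal.ofReal (‖star ψ ⬝ᵥ z‖ ^ 2 / 2)).map ULift.up := by
  ext s hs
  have hs' : MeasurableSet (ULift.up ⁻¹' s) := measurable_up hs
  have h1 := (integral_mul_normSq IsWeight.one ψ).1
  simp only [one_mul] at h1
  rw [POVM.bornMeasure_apply _ _ hs, gaussPOVM_apply hs, Measure.map_apply measurable_up hs,
    withDensity_apply _ hs', (integral_mul_normSq (isWeight_indicator hs') ψ).2,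
    ← ofReal_integral_eq_lintegral_ofReal h1.integrableOn (.of_forall fun _ => by positivity),
    ← integral_indicator hs', Complex.ofReal_re]
  congr 2
  ext z
  by_cases h : z ∈ ULift.up ⁻¹' s <;> simp [h]

lemma integral_bornMeasure_gaussPOVM {d : ℕ} {w' : (Fin d → ℂ) → ℝ} (hw : IsWeight w')
    (ψ : Fin d → ℂ) :
    star ψ ⬝ᵥ (gaussMatrix w' *ᵥ ψ) =
      ((∫ l, w' l.down ∂(gaussPOVM.{w} d).bornMeasure ψ : ℝ) : ℂ) := by
  have hm : Measurable fun l : ULift.{w} (Fin d → ℂ) => w' l.down :=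
    hw.measurable.comp measurable_down
  have hdens : Measurable fun z : Fin d → ℂ => ENNReal.ofReal (‖star ψ ⬝ᵥ z‖ ^ 2 / 2) := by
    unfold dotProduct
    fun_prop
  rw [bornMeasure_gaussPOVM, integral_map measurable_up.aemeasurable hm.aestronglyMeasurable,
    integral_withDensity_eq_integral_toReal_smul hdens (.of_forall fun _ => ENNReal.ofReal_lt_top),
    (integral_mul_normSq hw ψ).2]
  congr 2
  ext z
  rw [ENNReal.toReal_ofReal (by positivity), smul_eq_mul, mul_comm]

theorem jointlyMeasurable_threshold {d : ℕ} (hd : 2 ≤ d) {K : Type u} {O : K → Type v}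
    [∀ k, Fintype (O k)] (A : ∀ k, O k → Matrix (Fin d) (Fin d) ℂ) (hA : ∀ k, IsPVM (A k)) :
    JointlyMeasurable.{u, v, w} (fun k => noisy (threshold d) (A k)) := by
  have : NeZero d := ⟨by omega⟩
  choose U f hUf using fun k => (hA k).exists_basis
  refine ⟨ULift.{w} (Fin d → ℂ), inferInstance, gaussPOVM d,
    fun k x l => response (U k) (f k) x l.down,
    ⟨fun k x l => response_nonneg _ _ _ _, fun k l => sum_response _ _ _⟩,
    fun k x => (isWeight_response _ _ _).measurable.comp measurable_down, fun k x ψ => ?_⟩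
  beta_reduce
  rw [← gaussMatrix_response hd (U k) (f k) x (hUf k x)]
  exact integral_bornMeasure_gaussPOVM (isWeight_response _ _ _) ψ

/-- Given `z`, draw the answers to all settings independently and record them. The record `p : ∀ k,
O k` takes finitely many values and replaces `z` as parent outcome; reading off `p k` is then a
deterministic post-processing. -/
theorem finitelyJointlyMeasurable_threshold {d : ℕ} (hd : 2 ≤ d) {K : Type u} {O : K → Type v}
    [Finite K] [∀ k, Fintype (O k)] (A : ∀ k, O k → Matrix (Fin d) (Fin d) ℂ)
    (hA : ∀ k, IsPVM (A k)) :
    FinitelyJointlyMeasurable (fun k => noisy (threshold d) (A k)) := by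
  classical
  have : NeZero d := ⟨by omega⟩
  cases nonempty_fintype K
  choose U f hUf using fun k => (hA k).exists_basis
  let D : ∀ k, O k → (Fin d → ℂ) → ℝ := fun k x z => response (U k) (f k) x z
  have hD0 : ∀ k x z, 0 ≤ D k x z := fun k x z => response_nonneg _ _ _ _
  have hD1 : ∀ k z, ∑ x, D k x z = 1 := fun k z => sum_response _ _ _
  have hprod : ∀ p : ∀ k, O k, IsWeight fun z => ∏ k, D k (p k) z := fun p =>
    ⟨Finset.measurable_prod _ fun k _ => (isWeight_response _ _ _).measurable, fun z => by
      rw [Finset.abs_prod]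
      exact Finset.prod_le_one (fun _ _ => abs_nonneg _)
        fun k _ => (isWeight_response _ _ _).abs_le_one z⟩
  let e := Fintype.equivFin (∀ k, O k)
  refine ⟨_, fun l => gaussMatrix fun z => ∏ k, D k (e.symm l k) z,
    fun k x l => if e.symm l k = x then 1 else 0, ⟨fun l => ?_, ?_⟩, ⟨fun k x l => ?_, ?_⟩, ?_⟩
  · exact gaussMatrix_posSemidef (hprod _) fun z => Finset.prod_nonneg fun _ _ => hD0 _ _ _
  · rw [e.symm.sum_comp (fun p => gaussMatrix fun z => ∏ k, D k (p k) z),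
      ← gaussMatrix_sum _ _ fun p _ => hprod p, ← gaussMatrix_one]
    congr
    ext z
    rw [← Fintype.piFinset_univ, ← Finset.prod_univ_sum _ fun k x => D k x z]
    simp [hD1]
  · positivity
  · intro k l
    simp
  · intro k x
    beta_reduce
    rw [e.symm.sum_comp (fun p =>
      (((if p k = x then 1 else 0 : ℝ)) : ℂ) • gaussMatrix fun z => ∏ k, D k (p k) z),
      ← gaussMatrix_response hd (U k) (f k) x (hUf k x)]
    -- The records with `p k = x` form a product set, so the sum of products becomes a product of
    -- sums in which every factor but the `k`-th is 1.
    let s : ∀ k, Finset (O k) := Function.update (fun _ => Finset.univ) k {x}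
    have hs : ∀ p : ∀ k, O k, p ∈ Fintype.piFinset s ↔ p k = x := by
      intro p
      rw [Fintype.mem_piFinset]
      refine ⟨fun h => by simpa [s] using h k, fun h k' => ?_⟩
      by_cases hk : k' = k
      · subst hk
        simpa [s] using h
      · simp [s, hk]
    have h1 : ∀ p : ∀ k, O k, (((if p k = x then 1 else 0 : ℝ)) : ℂ) •
        (gaussMatrix fun z => ∏ k, D k (p k) z) =
        if p ∈ Fintype.piFinset s then gaussMatrix fun z => ∏ k, D k (p k) z else 0 := by
      intro p
      simp only [hs]
      split_ifs <;> simp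
    simp_rw [h1]
    rw [Finset.sum_ite_mem, Finset.univ_inter, ← gaussMatrix_sum _ _ fun p _ => hprod p]
    congr
    ext z
    rw [← Finset.prod_univ_sum _ fun k x => D k x z, Finset.prod_eq_single k]
    · simp [s, D]
    · intro k' _ hk
      simp [s, hk, hD1]
    · simp

/-! ### Averaging the largest overlap over bases -/

instance (d : ℕ) : SecondCountableTopology (Matrix (Fin d) (Fin d) ℂ) :=
  inferInstanceAs (SecondCountableTopology (Fin d → Fin d → ℂ))

instance (d : ℕ) : CompactSpace (unitaryGroup (Fin d) ℂ) := by
  refine (isCompact_iff_compactSpace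
    (s := (unitaryGroup (Fin d) ℂ : Set (Matrix (Fin d) (Fin d) ℂ)))).1 ?_
  have hK : IsCompact (Set.pi Set.univ fun _ : Fin d => Set.pi Set.univ fun _ : Fin d =>
      Metric.closedBall (0 : ℂ) 1) :=
    isCompact_univ_pi fun _ => isCompact_univ_pi fun _ => isCompact_closedBall 0 1
  refine IsCompact.of_isClosed_subset (X := Matrix (Fin d) (Fin d) ℂ) hK ?_ ?_
  · have : (unitaryGroup (Fin d) ℂ : Set (Matrix (Fin d) (Fin d) ℂ)) = {M | M * star M = 1} := by
      ext M
      exact mem_unitaryGroup_iff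
    rw [this]
    exact isClosed_eq (by fun_prop) continuous_const
  · intro M hM i _ j _
    rw [mem_closedBall_zero_iff]
    exact entry_norm_bound_of_unitary hM i j

lemma exists_unitary_mulVec_single {d : ℕ} (i : Fin d) (z : Fin d → ℂ) :
    ∃ V : unitaryGroup (Fin d) ℂ,
      z = ((√(∑ j, ‖z j‖ ^ 2) : ℝ) : ℂ) • (V.1 *ᵥ Pi.single i 1) := by
  let y : EuclideanSpace ℂ (Fin d) := WithLp.toLp 2 z
  have hy : ‖y‖ = √(∑ j, ‖z j‖ ^ 2) := EuclideanSpace.norm_eq y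
  by_cases h0 : y = 0
  · refine ⟨1, ?_⟩
    have : z = 0 := by simpa [y] using h0
    simp [this]
  have hn : ‖y‖ ≠ 0 := norm_ne_zero_iff.2 h0
  have hon : Orthonormal ℂ (({i} : Set (Fin d)).domRestrict fun _ => ((‖y‖⁻¹ : ℝ) : ℂ) • y) := by
    constructor
    · intro _
      simp [norm_smul, hn]
    · intro a b hab
      exact absurd (Subsingleton.elim a b) hab
  obtain ⟨b, hb⟩ := hon.exists_orthonormalBasis_extension_of_card_eq (by simp)
  refine ⟨⟨_, (EuclideanSpace.basisFun (Fin d) ℂ).toMatrix_orthonormalBasis_mem_unitary b⟩, ?_⟩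
  ext j
  have hbi := hb i rfl
  have hn' : (‖y‖ : ℂ) ≠ 0 := Complex.ofReal_ne_zero.2 hn
  rw [← hy]
  simp [Module.Basis.toMatrix_apply, hbi, mul_inv_cancel_left₀ hn']
  rfl

lemma continuous_norm_sq_star_mulVec {X : Type*} [TopologicalSpace X] {d : ℕ}
    {U : X → unitaryGroup (Fin d) ℂ} {z : X → Fin d → ℂ} (hU : Continuous U) (hz : Continuous z) :
    Continuous fun x => ‖star (U x).1 *ᵥ z x‖ ^ 2 :=
  (Continuous.norm (Continuous.matrix_mulVec (continuous_subtype_val.comp hU).star hz)).pow 2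

lemma norm_sq_le_sum {d : ℕ} (z : Fin d → ℂ) : ‖z‖ ^ 2 ≤ ∑ i, ‖z i‖ ^ 2 := by
  have h : 0 ≤ ∑ i, ‖z i‖ ^ 2 := Finset.sum_nonneg fun _ _ => sq_nonneg _
  rw [← Real.le_sqrt (norm_nonneg _) h, pi_norm_le_iff_of_nonneg (Real.sqrt_nonneg _)]
  intro i
  rw [Real.le_sqrt (norm_nonneg _) h]
  exact Finset.single_le_sum (fun j _ => sq_nonneg ‖z j‖) (Finset.mem_univ i)

/-- Left invariance and transitivity on spheres make the average `c` times the squared Euclidean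
norm. Integrating over Gaussian `z` and exchanging the integrals gives `2 H_d = 2 d c`. -/
lemma integral_norm_sq_star_mulVec_haar {d : ℕ} [NeZero d]
    [MeasurableSpace (unitaryGroup (Fin d) ℂ)] [BorelSpace (unitaryGroup (Fin d) ℂ)]
    (μ : Measure (unitaryGroup (Fin d) ℂ))
    [IsProbabilityMeasure μ] [μ.IsMulLeftInvariant] (z : Fin d → ℂ) :
    ∫ U, ‖star U.1 *ᵥ z‖ ^ 2 ∂μ = (∑ i, ‖z i‖ ^ 2) * (harmonic d / d) := by
  let c := ∫ U, ‖star U.1 *ᵥ Pi.single (0 : Fin d) 1‖ ^ 2 ∂μ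
  have hc : ∀ z : Fin d → ℂ, ∫ U, ‖star U.1 *ᵥ z‖ ^ 2 ∂μ = (∑ i, ‖z i‖ ^ 2) * c := by
    intro z
    obtain ⟨V, hV⟩ := exists_unitary_mulVec_single 0 z
    have h0 : 0 ≤ ∑ j, ‖z j‖ ^ 2 := Finset.sum_nonneg fun _ _ => sq_nonneg _
    have h1 : ∀ U : unitaryGroup (Fin d) ℂ, ‖star U.1 *ᵥ z‖ ^ 2 =
        (∑ i, ‖z i‖ ^ 2) * ‖star (V⁻¹ * U).1 *ᵥ Pi.single (0 : Fin d) 1‖ ^ 2 := by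
      intro U
      have h2 : star (V⁻¹ * U).1 = star U.1 * V.1 := by
        simp [UnitaryGroup.inv_val, star_eq_conjTranspose]
      conv_lhs => rw [hV]
      rw [mulVec_smul, norm_smul, mul_pow, Complex.norm_real, Real.norm_eq_abs, sq_abs,
        Real.sq_sqrt h0, h2, mulVec_mulVec]
    simp_rw [h1]
    rw [integral_const_mul, integral_mul_left_eq_self
      (fun U : unitaryGroup (Fin d) ℂ => ‖star U.1 *ᵥ Pi.single (0 : Fin d) 1‖ ^ 2) V⁻¹]
  have hi : ∀ i : Fin d, Integrable (fun z => ‖z i‖ ^ 2) (gaussianVector d) := fun i =>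
    (integrable_norm_sq_gaussianVector d).mono'
      ((measurable_pi_apply i).norm.pow_const 2).aestronglyMeasurable (.of_forall fun z => by
      rw [Real.norm_of_nonneg (sq_nonneg _)]
      have := norm_le_pi_norm z i
      gcongr)
  have hs : Integrable (fun z => ∑ i, ‖z i‖ ^ 2) (gaussianVector d) :=
    integrable_finsetSum _ fun i _ => hi i
  have hprod : Integrable (fun p : unitaryGroup (Fin d) ℂ × (Fin d → ℂ) => ‖star p.1.1 *ᵥ p.2‖ ^ 2)
      (μ.prod (gaussianVector d)) := by
    refine (hs.comp_snd μ).mono' (continuous_norm_sq_star_mulVec continuous_fst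
      continuous_snd).aestronglyMeasurable
      (.of_forall fun p => ?_)
    rw [Real.norm_of_nonneg (sq_nonneg _), ← sum_norm_sq_mulVec (star p.1) p.2]
    exact norm_sq_le_sum _
  have hswap := integral_integral_swap
    (f := fun (U : unitaryGroup (Fin d) ℂ) (z : Fin d → ℂ) => ‖star U.1 *ᵥ z‖ ^ 2) hprod
  have hU : ∀ U : unitaryGroup (Fin d) ℂ,
      ∫ z, ‖star U.1 *ᵥ z‖ ^ 2 ∂gaussianVector d = 2 * harmonic d := by
    intro U
    have := integral_mulVec_gaussianVector (star U) (fun z => ((‖z‖ ^ 2 : ℝ) : ℂ)) (by fun_prop)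
    rw [integral_complex_ofReal, integral_complex_ofReal, integral_norm_sq_gaussianVector] at this
    exact_mod_cast this
  simp only [hU, hc, integral_const, probReal_univ, one_smul] at hswap
  rw [integral_mul_const, integral_finsetSum _ fun i _ => hi i] at hswap
  simp only [integral_norm_apply_sq_gaussianVector, Finset.sum_const, Finset.card_univ,
    Fintype.card_fin, nsmul_eq_mul] at hswap
  rw [hc z]
  have hd0 : (d : ℝ) ≠ 0 := Nat.cast_ne_zero.2 (NeZero.ne d)
  congr 1
  field_simp
  linarith

/-- The averages of a continuous family of functions on a compact space are uniformly approximated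
by finite convex combinations. -/
lemma exists_finite_convexCombination {X Y : Type*} [TopologicalSpace X] [CompactSpace X]
    [R1Space X] [MeasurableSpace X] [BorelSpace X] [TopologicalSpace Y] [CompactSpace Y]
    (μ : Measure X) [IsProbabilityMeasure μ] (F : C(X × Y, ℝ)) {ε : ℝ} (hε : 0 < ε) :
    ∃ (N : ℕ) (p : Fin N → ℝ) (x : Fin N → X), (∀ k, 0 ≤ p k) ∧ ∑ k, p k = 1 ∧
      ∀ y, |∫ x, F (x, y) ∂μ - ∑ k, p k * F (x k, y)| < ε := by
  have hF : Integrable F.curry μ :=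
    F.curry.continuous.integrable_of_hasCompactSupport (HasCompactSupport.of_compactSpace _)
  -- The integral is taken in `C(Y, ℝ)`, where it lies in the closed convex hull of the integrand's
  -- range; closeness in the sup norm is uniformity in `y`.
  have hmem := (convex_convexHull ℝ (Set.range F.curry)).closure.integral_mem isClosed_closure
    (.of_forall fun U => subset_closure (subset_convexHull ℝ _ (Set.mem_range_self U))) hF
  obtain ⟨g, hg, hdist⟩ := Metric.mem_closure_iff.1 hmem ε hε
  obtain ⟨ι, _, p, f, hp0, hp1, hf, rfl⟩ := mem_convexHull_iff_exists_fintype.1 hg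
  choose x hx using hf
  let e := Fintype.equivFin ι
  refine ⟨_, p ∘ e.symm, x ∘ e.symm, fun k => hp0 _, ?_, fun y => ?_⟩
  · simp only [Function.comp]
    rw [e.symm.sum_comp p, hp1]
  have h1 := (ContinuousMap.dist_apply_le_dist y).trans_lt hdist
  rw [ContinuousMap.integral_apply hF, Real.dist_eq, ContinuousMap.sum_apply] at h1
  simp only [Function.comp]
  rw [e.symm.sum_comp fun i => p i * F (x i, y)]
  simpa [← hx] using h1

lemma exists_haar_unitaryGroup (d : ℕ) [MeasurableSpace (unitaryGroup (Fin d) ℂ)]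
    [BorelSpace (unitaryGroup (Fin d) ℂ)] : ∃ μ : Measure (unitaryGroup (Fin d) ℂ),
      IsProbabilityMeasure μ ∧ μ.IsMulLeftInvariant :=
  ⟨Measure.haarMeasure ⊤, ⟨Measure.haarMeasure_self⟩, inferInstance⟩

/-- The unit sphere of `ℂ^d` for the Euclidean norm. -/
def unitSphere (d : ℕ) : Set (Fin d → ℂ) := {z | ∑ i, ‖z i‖ ^ 2 = 1}

instance (d : ℕ) : CompactSpace (unitSphere d) := by
  refine isCompact_iff_compactSpace.1 (IsCompact.of_isClosed_subset
    (isCompact_closedBall (0 : Fin d → ℂ) 1)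
    (isClosed_eq (by fun_prop) continuous_const) fun z hz => ?_)
  rw [mem_closedBall_zero_iff, ← sq_le_one_iff₀ (norm_nonneg _)]
  exact (norm_sq_le_sum z).trans_eq hz

/-- Finitely many bases approximate the Haar average of the largest overlap, uniformly in the
vector. -/
lemma exists_finite_average {d : ℕ} [NeZero d] {ε : ℝ} (hε : 0 < ε) :
    ∃ (N : ℕ) (p : Fin N → ℝ) (U : Fin N → unitaryGroup (Fin d) ℂ),
      (∀ k, 0 ≤ p k) ∧ ∑ k, p k = 1 ∧
      ∀ z : Fin d → ℂ, ∑ k, p k * ‖star (U k).1 *ᵥ z‖ ^ 2 ≤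
        (harmonic d / d + ε) * ∑ i, ‖z i‖ ^ 2 := by
  let _ : MeasurableSpace (unitaryGroup (Fin d) ℂ) := borel _
  have : BorelSpace (unitaryGroup (Fin d) ℂ) := ⟨rfl⟩
  obtain ⟨μ, _, _⟩ := exists_haar_unitaryGroup d
  obtain ⟨N, p, U, hp0, hp1, hU⟩ := exists_finite_convexCombination μ
    (Y := unitSphere d) ⟨fun p => ‖star p.1.1 *ᵥ p.2.1‖ ^ 2, continuous_norm_sq_star_mulVec
      continuous_fst (continuous_subtype_val.comp continuous_snd)⟩ hε
  refine ⟨N, p, U, hp0, hp1, fun z => ?_⟩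
  have hunit : ∀ z ∈ unitSphere d, ∑ i, p i * ‖star (U i).1 *ᵥ z‖ ^ 2 ≤ harmonic d / d + ε := by
    intro z hz
    have h1 := hU ⟨z, hz⟩
    have hz' : ∑ i, ‖z i‖ ^ 2 = 1 := hz
    simp only [ContinuousMap.coe_mk] at h1
    rw [integral_norm_sq_star_mulVec_haar μ z, hz', one_mul] at h1
    linarith [(abs_lt.1 h1).1]
  have h0 : 0 ≤ ∑ j, ‖z j‖ ^ 2 := Finset.sum_nonneg fun _ _ => sq_nonneg _
  -- Both sides are homogeneous of degree two, so the bound passes from the compact unit sphere to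
  -- all `z`, including `z = 0`.
  obtain ⟨V, hV⟩ := exists_unitary_mulVec_single 0 z
  have hy : V.1 *ᵥ Pi.single 0 1 ∈ unitSphere d := by
    change ∑ i, _ = _
    rw [sum_norm_sq_mulVec, Finset.sum_eq_single 0]
    · simp
    · intro i _ hi
      simp [hi]
    · simp
  have h1 : ∀ i, p i * ‖star (U i).1 *ᵥ z‖ ^ 2 =
      (p i * ‖star (U i).1 *ᵥ (V.1 *ᵥ Pi.single 0 1)‖ ^ 2) * ∑ j, ‖z j‖ ^ 2 := by
    intro i
    conv_lhs => rw [hV]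
    rw [mulVec_smul, norm_smul, mul_pow, Complex.norm_real, Real.norm_eq_abs, sq_abs,
      Real.sq_sqrt h0]
    ring
  simp_rw [h1]
  rw [← Finset.sum_mul]
  exact mul_le_mul_of_nonneg_right (hunit _ hy) h0

/-! ### Incompatibility above the threshold -/

lemma isPVM_basisProj {d : ℕ} (U : unitaryGroup (Fin d) ℂ) : IsPVM (basisProj U) := by
  have hU := UnitaryGroup.star_mul_self U
  refine ⟨fun x => ⟨?_, ?_⟩, ?_⟩
  · change basisProj U x * basisProj U x = basisProj U x
    calc U.1 * single x x 1 * star U.1 * (U.1 * single x x 1 * star U.1)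
        = U.1 * single x x 1 * (star U.1 * U.1) * single x x 1 * star U.1 := by
          simp only [mul_assoc]
      _ = _ := by
          rw [hU, mul_one, mul_assoc U.1, single_mul_single_same, mul_one]
          rfl
  · change star (basisProj U x) = basisProj U x
    simp only [basisProj, star_mul, star_star, mul_assoc]
    simp [star_eq_conjTranspose]
  · simp only [basisProj]
    rw [← Finset.sum_mul, ← Finset.mul_sum, sum_single_one, mul_one, mem_unitaryGroup_iff.1 U.2]

/-- The `x`-th column of a unitary matrix. -/
noncomputable def basisVec {d : ℕ} (U : unitaryGroup (Fin d) ℂ) (x : Fin d) : Fin d → ℂ :=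
  U.1 *ᵥ Pi.single x 1

lemma star_basisVec_dotProduct {d : ℕ} (U : unitaryGroup (Fin d) ℂ) (x : Fin d) :
    star (basisVec U x) ⬝ᵥ basisVec U x = 1 := by
  rw [← sum_norm_sq_eq_dotProduct, basisVec, sum_norm_sq_mulVec, Finset.sum_eq_single x]
  · simp
  · intro i _ hi
    simp [hi]
  · simp

lemma noisy_basisProj_basisVec {d : ℕ} (t : ℝ) (U : unitaryGroup (Fin d) ℂ) (x : Fin d) :
    star (basisVec U x) ⬝ᵥ (noisy t (basisProj U) x *ᵥ basisVec U x) =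
      ((t + (1 - t) / d : ℝ) : ℂ) := by
  have hx : single x x (1 : ℂ) *ᵥ Pi.single x 1 = Pi.single x 1 := by
    ext i
    simp [single_apply, Pi.single_apply, eq_comm]
  have h : basisProj U x *ᵥ basisVec U x = basisVec U x := by
    rw [basisVec, basisProj, mulVec_mulVec, mul_assoc, UnitaryGroup.star_mul_self, mul_one,
      ← mulVec_mulVec, hx]
  rw [noisy, trace_basisProj, add_mulVec, smul_mulVec, smul_mulVec, one_mulVec, h, mul_one,
    dotProduct_add, dotProduct_smul, dotProduct_smul, star_basisVec_dotProduct]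
  simp

open scoped MatrixOrder Matrix.Norms.L2Operator in
lemma _root_.Matrix.PosSemidef.exists_eq_conjTranspose_mul_self {d : ℕ}
    {G : Matrix (Fin d) (Fin d) ℂ} (hG : G.PosSemidef) :
    ∃ C : Matrix (Fin d) (Fin d) ℂ, G = Cᴴ * C :=
  CStarAlgebra.nonneg_iff_eq_star_mul_self.mp hG.nonneg

/-- The average success probability of a single effect is bounded by its trace. -/
lemma sum_le_trace {d N : ℕ} {p : Fin N → ℝ} {U : Fin N → unitaryGroup (Fin d) ℂ} {M : ℝ}
    (hp : ∀ k, 0 ≤ p k)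
    (hM : ∀ z : Fin d → ℂ, ∑ k, p k * ‖star (U k).1 *ᵥ z‖ ^ 2 ≤ M * ∑ i, ‖z i‖ ^ 2)
    {G : Matrix (Fin d) (Fin d) ℂ} (hG : G.PosSemidef) {v : Fin N → Fin d → ℝ}
    (hv0 : ∀ k x, 0 ≤ v k x) (hv1 : ∀ k, ∑ x, v k x = 1) :
    ∑ k, p k * ∑ x, v k x * (star (basisVec (U k) x) ⬝ᵥ (G *ᵥ basisVec (U k) x)).re ≤
      M * ∑ i, (star (Pi.single i 1) ⬝ᵥ (G *ᵥ Pi.single i 1)).re := by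
  -- The rows of `C` split `G` into rank-one effects, to each of which `hM` applies.
  obtain ⟨C, rfl⟩ := hG.exists_eq_conjTranspose_mul_self
  have hquad : ∀ z : Fin d → ℂ, (star z ⬝ᵥ ((Cᴴ * C) *ᵥ z)).re = ∑ r, ‖(C *ᵥ z) r‖ ^ 2 := by
    intro z
    rw [← mulVec_mulVec, dotProduct_mulVec, ← star_mulVec, ← sum_norm_sq_eq_dotProduct,
      Complex.ofReal_re]
  have hcol : ∀ k x r, ‖(C *ᵥ basisVec (U k) x) r‖ = ‖(star (U k).1 *ᵥ star (C r)) x‖ := by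
    intro k x r
    rw [← norm_star]
    congr 1
    simp [basisVec, mulVec, dotProduct, Pi.single_apply, mul_comm]
  simp_rw [hquad, hcol]
  -- A convex combination of squared overlaps is at most the largest one: guessing the largest
  -- coordinate is optimal.
  have hrow : ∀ k r, ∑ x, v k x * ‖(star (U k).1 *ᵥ star (C r)) x‖ ^ 2 ≤
      ‖star (U k).1 *ᵥ star (C r)‖ ^ 2 := by
    intro k r
    rw [← one_mul (‖star (U k).1 *ᵥ star (C r)‖ ^ 2), ← hv1 k, Finset.sum_mul]
    refine Finset.sum_le_sum fun x _ => mul_le_mul_of_nonneg_left ?_ (hv0 k x)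
    have := norm_le_pi_norm (star (U k).1 *ᵥ star (C r)) x
    gcongr
  calc ∑ k, p k * ∑ x, v k x * ∑ r, ‖(star (U k).1 *ᵥ star (C r)) x‖ ^ 2
      = ∑ r, ∑ k, p k * ∑ x, v k x * ‖(star (U k).1 *ᵥ star (C r)) x‖ ^ 2 := by
        rw [Finset.sum_comm]
        refine Finset.sum_congr rfl fun k _ => ?_
        rw [← Finset.mul_sum, Finset.sum_comm]
        simp_rw [Finset.mul_sum]
    _ ≤ ∑ r, ∑ k, p k * ‖star (U k).1 *ᵥ star (C r)‖ ^ 2 :=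
        Finset.sum_le_sum fun r _ => Finset.sum_le_sum fun k _ =>
          mul_le_mul_of_nonneg_left (hrow k r) (hp k)
    _ ≤ ∑ r, M * ∑ i, ‖star (C r) i‖ ^ 2 := Finset.sum_le_sum fun r _ => hM _
    _ = M * ∑ i, ∑ r, ‖(C *ᵥ Pi.single i 1) r‖ ^ 2 := by
        rw [← Finset.mul_sum, Finset.sum_comm]
        simp

namespace POVM

variable {d : ℕ} {L : Type*} [MeasurableSpace L]

instance (G : POVM d L) (ψ : Fin d → ℂ) : IsFiniteMeasure (G.bornMeasure ψ) :=
  ⟨by rw [G.bornMeasure_apply ψ .univ]; exact ENNReal.ofReal_lt_top⟩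

lemma bornMeasure_real (G : POVM d L) (ψ : Fin d → ℂ) {s : Set L} (hs : MeasurableSet s) :
    (G.bornMeasure ψ).real s = (star ψ ⬝ᵥ (G.toVectorMeasure s *ᵥ ψ)).re := by
  rw [measureReal_def, G.bornMeasure_apply ψ hs, ENNReal.toReal_ofReal]
  exact (G.posSemidef s hs).re_dotProduct_nonneg ψ

end POVM

/-- The set of families of probability distributions. -/
def distributions (N d : ℕ) : Set (Fin N → Fin d → ℝ) :=
  {v | (∀ k x, 0 ≤ v k x) ∧ ∀ k, ∑ x, v k x = 1}

/-- On each fibre of `s` the response is constant, so `sum_le_trace` applies to the effect of that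
fibre; the traces of these effects add up to `tr 1 = d`. -/
lemma sum_integral_simpleFunc_le {d N : ℕ} {L : Type*} [MeasurableSpace L] (G : POVM d L)
    {p : Fin N → ℝ} {U : Fin N → unitaryGroup (Fin d) ℂ} {M : ℝ} (hp : ∀ k, 0 ≤ p k)
    (hM : ∀ z : Fin d → ℂ, ∑ k, p k * ‖star (U k).1 *ᵥ z‖ ^ 2 ≤ M * ∑ i, ‖z i‖ ^ 2)
    (s : SimpleFunc L (Fin N → Fin d → ℝ)) (hs : ∀ l, s l ∈ distributions N d) :
    ∑ k, p k * ∑ x, ∫ l, s l k x ∂G.bornMeasure (basisVec (U k) x) ≤ M * d := by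
  have hint : ∀ k x, ∫ l, s l k x ∂G.bornMeasure (basisVec (U k) x) =
      ∑ v ∈ s.range, v k x * (star (basisVec (U k) x) ⬝ᵥ
        (G.toVectorMeasure (s ⁻¹' {v}) *ᵥ basisVec (U k) x)).re := by
    intro k x
    have h := s.map_integral (fun v => v k x) (μ := G.bornMeasure (basisVec (U k) x))
      s.integrable_of_isFiniteMeasure rfl
    rw [SimpleFunc.integral_eq_integral _ (SimpleFunc.integrable_of_isFiniteMeasure _)] at h
    rw [show (fun l => s l k x) = s.map (fun v => v k x) from rfl, h]
    refine Finset.sum_congr rfl fun v _ => ?_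
    rw [G.bornMeasure_real _ (s.measurableSet_fiber v), smul_eq_mul, mul_comm]
  simp_rw [hint]
  calc ∑ k, p k * ∑ x, ∑ v ∈ s.range, v k x * (star (basisVec (U k) x) ⬝ᵥ
        (G.toVectorMeasure (s ⁻¹' {v}) *ᵥ basisVec (U k) x)).re
      = ∑ v ∈ s.range, ∑ k, p k * ∑ x, v k x * (star (basisVec (U k) x) ⬝ᵥ
        (G.toVectorMeasure (s ⁻¹' {v}) *ᵥ basisVec (U k) x)).re := by
        rw [Finset.sum_comm]
        refine Finset.sum_congr rfl fun k _ => ?_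
        rw [← Finset.mul_sum, Finset.sum_comm]
    _ ≤ ∑ v ∈ s.range, M * ∑ i, (star (Pi.single i 1) ⬝ᵥ
        (G.toVectorMeasure (s ⁻¹' {v}) *ᵥ Pi.single i 1)).re := by
        refine Finset.sum_le_sum fun v hv => ?_
        obtain ⟨l, rfl⟩ := SimpleFunc.mem_range.1 hv
        exact sum_le_trace hp hM (G.posSemidef _ (s.measurableSet_fiber _)) (hs l).1 (hs l).2
    _ = M * ∑ i : Fin d, (1 : ℝ) := by
        rw [← Finset.mul_sum, Finset.sum_comm]
        congr 1
        refine Finset.sum_congr rfl fun i _ => ?_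
        have h := sum_measureReal_preimage_singleton (μ := G.bornMeasure (Pi.single i 1))
          s.range (f := s) fun v _ => s.measurableSet_fiber v
        rw [SimpleFunc.coe_range, Set.preimage_range, G.bornMeasure_real _ .univ,
          G.univ_eq_one] at h
        rw [← Finset.sum_congr rfl fun v _ =>
          G.bornMeasure_real (Pi.single i 1) (s.measurableSet_fiber v), h]
        simp
    _ = M * d := by simp

/-- Simple approximants with values in `distributions` are themselves valid responses, bounded by 1,
so dominated convergence carries the bound to the limit. -/
lemma sum_integral_le {d N : ℕ} [NeZero d] {L : Type*} [MeasurableSpace L] (G : POVM d L)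
    {p : Fin N → ℝ} {U : Fin N → unitaryGroup (Fin d) ℂ} {M : ℝ} (hp : ∀ k, 0 ≤ p k)
    (hM : ∀ z : Fin d → ℂ, ∑ k, p k * ‖star (U k).1 *ᵥ z‖ ^ 2 ≤ M * ∑ i, ‖z i‖ ^ 2)
    {D : Fin N → Fin d → L → ℝ} (hD : ∀ l, (fun k x => D k x l) ∈ distributions N d)
    (hDm : ∀ k x, Measurable (D k x)) :
    ∑ k, p k * ∑ x, ∫ l, D k x l ∂G.bornMeasure (basisVec (U k) x) ≤ M * d := by
  have hd0 : (d : ℝ) ≠ 0 := Nat.cast_ne_zero.2 (NeZero.ne d)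
  have hmeas : Measurable fun l k x => D k x l :=
    measurable_pi_lambda _ fun k => measurable_pi_lambda _ fun x => hDm k x
  -- The uniform distribution is the base point that `SimpleFunc.approxOn` needs.
  have h0 : (fun _ _ => (d : ℝ)⁻¹) ∈ distributions N d :=
    ⟨fun _ _ => by positivity, fun _ => by simp [hd0]⟩
  let s : ℕ → SimpleFunc L (Fin N → Fin d → ℝ) :=
    SimpleFunc.approxOn _ hmeas (distributions N d) _ h0
  have hs : ∀ n l, s n l ∈ distributions N d := fun n l => SimpleFunc.approxOn_mem _ _ _ _
  have hlim : ∀ l, Filter.Tendsto (fun n => s n l) Filter.atTop (nhds fun k x => D k x l) :=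
    fun l => SimpleFunc.tendsto_approxOn hmeas h0 (subset_closure (hD l))
  refine le_of_tendsto' (x := Filter.atTop) (f := fun n => ∑ k, p k * ∑ x,
    ∫ l, s n l k x ∂G.bornMeasure (basisVec (U k) x)) ?_
    fun n => sum_integral_simpleFunc_le G hp hM (s n) (hs n)
  refine tendsto_finsetSum _ fun k _ => (tendsto_finsetSum _ fun x _ => ?_).const_mul _
  refine tendsto_integral_of_dominated_convergence (fun _ => 1) (fun n => ?_)
    (integrable_const _) (fun n => .of_forall fun l => ?_) (.of_forall fun l => ?_)
  · exact ((s n).map fun v => v k x).aestronglyMeasurable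
  · rw [Real.norm_of_nonneg ((hs n l).1 k x), ← (hs n l).2 k]
    exact Finset.single_le_sum (fun y _ => (hs n l).1 k y) (Finset.mem_univ x)
  · exact tendsto_pi_nhds.1 (tendsto_pi_nhds.1 (hlim l) k) x

theorem exists_not_jointlyMeasurable {d : ℕ} (hd : 2 ≤ d) {t : ℝ} (ht : threshold d < t) :
    ∃ (N : ℕ) (A : Fin N → Fin d → Matrix (Fin d) (Fin d) ℂ), (∀ k, IsPVM (A k)) ∧
      ¬ JointlyMeasurable.{0, 0, w} (fun k => noisy t (A k)) := by
  have : NeZero d := ⟨by omega⟩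
  have hd2 : (2 : ℝ) ≤ d := by exact_mod_cast hd
  have hd0 : (0 : ℝ) < d := by linarith
  have hd1 : (0 : ℝ) < d - 1 := by linarith
  -- With this `ε`, the slack `dε` is half of the gap `(dt + 1 - t) - H_d = (t - λ*)(d - 1)`.
  have hε : 0 < (t - threshold d) * (d - 1) / (2 * d) := by
    have := sub_pos.2 ht
    positivity
  obtain ⟨N, p, U, hp0, hp1, hM⟩ := exists_finite_average (d := d) hε
  refine ⟨N, fun k => basisProj (U k), fun k => isPVM_basisProj _, ?_⟩
  rintro ⟨L, _, G, D, hD, hDm, hG⟩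
  have hle := sum_integral_le G hp0 hM (D := D)
    (fun l => ⟨fun k x => hD.nonneg k x l, fun k => hD.sum_eq_one k l⟩) hDm
  have hval : ∀ k x, ∫ l, D k x l ∂G.bornMeasure (basisVec (U k) x) = t + (1 - t) / d := by
    intro k x
    have := hG k x (basisVec (U k) x)
    rw [noisy_basisProj_basisVec] at this
    exact_mod_cast this.symm
  simp only [hval, Finset.sum_const, Finset.card_univ, Fintype.card_fin, nsmul_eq_mul] at hle
  rw [← Finset.sum_mul, hp1, one_mul] at hle
  have hthr : threshold d * (d - 1) = harmonic d - 1 := div_mul_cancel₀ _ hd1.ne'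
  have e1 : (d : ℝ) * (t + (1 - t) / d) = d * t + (1 - t) := by field_simp
  have e2 : ((harmonic d : ℝ) / d + (t - threshold d) * (d - 1) / (2 * d)) * d =
      harmonic d + (t - threshold d) * (d - 1) / 2 := by field_simp
  rw [e1, e2] at hle
  have := mul_pos (sub_pos.2 ht) hd1
  linarith

end QM

theorem mainTheorem3 (d : ℕ) (hd : 2 ≤ d) :
    -- every set of PVMs is jointly measurable at the threshold visibility
    (∀ (K : Type u) (O : K → Type v) [∀ k, Fintype (O k)]
        (A : ∀ k, O k → Matrix (Fin d) (Fin d) ℂ), (∀ k, QM.IsPVM (A k)) →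
        QM.JointlyMeasurable.{u, v, w} (fun k => QM.noisy (QM.threshold d) (A k))) ∧
    -- for a finite set of PVMs, finitely many outcomes of the parent observable suffice
    (∀ (K : Type u) (O : K → Type v) [Finite K] [∀ k, Fintype (O k)]
        (A : ∀ k, O k → Matrix (Fin d) (Fin d) ℂ), (∀ k, QM.IsPVM (A k)) →
        QM.FinitelyJointlyMeasurable (fun k => QM.noisy (QM.threshold d) (A k))) ∧
    -- above the threshold some finite set of PVMs is not jointly measurable
    (∀ t : ℝ, QM.threshold d < t → t ≤ 1 →
        ∃ (N : ℕ) (A : Fin N → Fin d → Matrix (Fin d) (Fin d) ℂ), (∀ k, QM.IsPVM (A k)) ∧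
          ¬ QM.JointlyMeasurable.{0, 0, w} (fun k => QM.noisy t (A k))) := by
  refine ⟨fun K O _ A hA => QM.jointlyMeasurable_threshold hd A hA,
    fun K O _ _ A hA => QM.finitelyJointlyMeasurable_threshold hd A hA,
    fun t ht _ => QM.exists_not_jointlyMeasurable hd ht⟩
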